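/- Conventions. The plane is identified with $\mathbb{C}$, and $\overline{\,\cdot\,}$ is complex conjugation. A direction is a point of the unit circle. A convex polygon is the convex hull of a finite set of points; it is a polygon in $S\subset\mathbb{C}$ if all its vertices lie in $S$. An affinely regular polygon is the image of a (convex, non-degenerate) regular polygon under a non-singular affine transformation of the plane. For $\Lambda\subset\mathbb{C}$, a direction is a $\Lambda$-direction if it is parallel to a non-zero element of $\Lambda-\Lambda$. For a finite set $U$ of pairwise non-parallel directions, a non-degenerate convex polygon $P$ is a $U$-polygon if, for every vertex $v$ of $P$ and every $u\in U$, the line through $v$ in direction $u$ meets another vertex of $P$. A $U$-polygon $P$ is of class $c$ with respect to $U$, $0<c\le\operatorname{card}(U)$, if $c$ is the maximal number of consecutive edges of $P$ whose directions belong to $U$ (up to sign), where only runs of at most $\operatorname{card}(U)$ consecutive edges are counted (so that the class is $\operatorname{card}(U)$ if the directions of all edges belong to $U$). For $n\ge 1$ let $\zeta_n=e^{2\pi i/n}$ and $\Bbbk_n=\mathbb{Q}(\zeta_n+\overline{\zeta_n})$. Statement. Let $\mathbb{L}\subset\mathbb{C}$ be an algebraic number field with $\mathbb{L}\not\subset\mathbb{R}$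 and $\overline{\mathbb{L}}=\mathbb{L}$, let $\mathcal{O}_{\mathbb{L}}$ be its ring of integers, and let $\mathbb{l}=\mathbb{L}\cap\mathbb{R}$ be its maximal real subfield. Let $\Lambda$ be a translate of $\mathbb{L}$ or a translate of $\mathcal{O}_{\mathbb{L}}$. Then, for every even number $m\ge 8$, the following statements are equivalent: (i) There is a $U$-polygon of class $c\ge 4$ in $\Lambda$ with $m$ edges, for some finite set $U$ of pairwise non-parallel directions. (ii) There is an affinely regular $U$-polygon of class $c\ge 4$ with $m$ edges, for some finite set $U$ of pairwise non-parallel $\Lambda$-directions. (iii) $\Bbbk_{m/2}\subset\mathbb{l}$. (iv) There is an affinely regular polygon in $\Lambda$ with $\operatorname{lcm}(m/2,2)$ edges. Moreover, these statements hold for only finitely many even numbers $m\ge 8$. -/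

import Mathlib

namespace UPolygons

open scoped ComplexConjugate

/-! The Euclidean plane is identified with `ℂ`, and the set of directions with the unit circle
`Circle`. -/

/-- Two non-zero vectors of the plane are parallel if one is a non-zero real multiple of the
other. -/
def Parallel (u w : ℂ) : Prop := ∃ r : ℝ, r ≠ 0 ∧ w = (r : ℂ) * u

/-- The oriented area `det (z, w)`. -/
def cross (z w : ℂ) : ℝ := z.re * w.im - z.im * w.re

/-- `v` lists, in counterclockwise order, the vertices of a non-degenerate convex polygon with
`n` vertices (equivalently, with `n` edges): all vertices different from `v i` and `v (i + 1)` lie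
strictly to the left of the oriented line from `v i` to `v (i + 1)`. The polygon is the convex hull
of the range of `v`, and its `n` edges are the segments from `v i` to `v (i + 1)`, `i : ZMod n`. -/
def IsConvexPolygon (n : ℕ) (v : ZMod n → ℂ) : Prop :=
  3 ≤ n ∧ ∀ i j : ZMod n, j ≠ i → j ≠ i + 1 → 0 < cross (v (i + 1) - v i) (v j - v i)

/-- The polygon with vertices `v` is a polygon in `S`, that is, all its vertices lie in `S`. -/
def IsIn {n : ℕ} (v : ZMod n → ℂ) (S : Set ℂ) : Prop := ∀ i, v i ∈ S

/-- The primitive root of unity `ζ_n = e^{2πi/n}`. -/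
noncomputable def zeta (n : ℕ) : ℂ := Complex.exp (2 * Real.pi * Complex.I / n)

/-- `w` lists the vertices of a regular `n`-gon in cyclic order. -/
def IsRegularPolygon (n : ℕ) (w : ZMod n → ℂ) : Prop :=
  3 ≤ n ∧ ∃ a r : ℂ, r ≠ 0 ∧ ∀ i, w i = a + r * zeta n ^ i.val

/-- `v` lists the vertices of an affinely regular `n`-gon in cyclic order: it is the image of a
regular `n`-gon under a non-singular affine transformation of the plane. -/
def IsAffinelyRegularPolygon (n : ℕ) (v : ZMod n → ℂ) : Prop :=
  ∃ w : ZMod n → ℂ, IsRegularPolygon n w ∧ ∃ Ψ : ℂ ≃ᵃ[ℝ] ℂ, ∀ i, v i = Ψ (w i)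

/-- The convex polygon with vertices `v` (in counterclockwise order) is a `U`-polygon, where `U` is
a finite set of pairwise non-parallel directions: for every vertex and every `u ∈ U`, the line in
direction `u` through this vertex meets another vertex. -/
def IsUPolygon (U : Finset Circle) (n : ℕ) (v : ZMod n → ℂ) : Prop :=
  (∀ u ∈ U, ∀ u' ∈ U, u ≠ u' → ¬ Parallel (u : ℂ) (u' : ℂ)) ∧
  IsConvexPolygon n v ∧
  ∀ i, ∀ u ∈ U, ∃ j, j ≠ i ∧ Parallel (u : ℂ) (v j - v i)

/-- The direction of the edge from `v i` to `v (i + 1)` belongs to `U` (directions being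
considered up to sign). -/
def EdgeIn (U : Finset Circle) {n : ℕ} (v : ZMod n → ℂ) (i : ZMod n) : Prop :=
  ∃ u ∈ U, Parallel (u : ℂ) (v (i + 1) - v i)

/-- The `U`-polygon with vertices `v` is of class `c` with respect to `U`, `0 < c ≤ card U`: `c` is
the maximal number of consecutive edges whose directions belong to `U`. The bound `k ≤ card U` says
that a run of consecutive edges does not use a direction twice; it matters only if the directions
of all edges belong to `U`, and then the class is `card U`. -/
def IsOfClass (U : Finset Circle) {n : ℕ} (v : ZMod n → ℂ) (c : ℕ) : Prop :=
  0 < c ∧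
  IsGreatest {k : ℕ | k ≤ U.card ∧ ∃ i : ZMod n, ∀ j : ℕ, j < k → EdgeIn U v (i + (j : ZMod n))} c

/-- `u` is a `Λ`-direction: it is parallel to a non-zero element of `Λ - Λ`. -/
def IsDirectionOf (Λ : Set ℂ) (u : Circle) : Prop :=
  ∃ x ∈ Λ, ∃ y ∈ Λ, x - y ≠ 0 ∧ Parallel (u : ℂ) (x - y)

/-- The field `k_n = ℚ(ζ_n + conj ζ_n)`. -/
noncomputable def realCyclotomic (n : ℕ) : IntermediateField ℚ ℂ :=
  IntermediateField.adjoin ℚ {zeta n + conj (zeta n)}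

/-- The field of real numbers as a subfield of `ℂ`. -/
noncomputable def realSubfield : IntermediateField ℚ ℂ :=
  (IsScalarTower.toAlgHom ℚ ℝ ℂ).fieldRange

/-- The maximal real subfield `L ∩ ℝ` of a subfield `L` of `ℂ`. -/
noncomputable def maxRealSubfield (L : IntermediateField ℚ ℂ) : IntermediateField ℚ ℂ :=
  L ⊓ realSubfield

/-- The ring of integers of `L`, as a subset of `ℂ`. -/
def integersOf (L : IntermediateField ℚ ℂ) : Set ℂ :=
  Set.range fun x : NumberField.RingOfIntegers L => ((x : L) : ℂ)

/-- `Λ` is a translate of `S`. -/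
def IsTranslateOf (Λ S : Set ℂ) : Prop := ∃ t : ℂ, Λ = (fun z => z + t) '' S

/-- There is a `U`-polygon of class `c ≥ 4` in `Λ` with `m` edges. -/
def HasUPolygon (Λ : Set ℂ) (m : ℕ) : Prop :=
  ∃ (U : Finset Circle) (v : ZMod m → ℂ) (c : ℕ),
    4 ≤ c ∧ IsUPolygon U m v ∧ IsOfClass U v c ∧ IsIn v Λ

/-- There is an affinely regular `U`-polygon of class `c ≥ 4` with `m` edges for a set `U` of
`Λ`-directions. -/
def HasAffinelyRegularUPolygon (Λ : Set ℂ) (m : ℕ) : Prop :=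
  ∃ (U : Finset Circle) (v : ZMod m → ℂ) (c : ℕ),
    4 ≤ c ∧ (∀ u ∈ U, IsDirectionOf Λ u) ∧ IsUPolygon U m v ∧ IsOfClass U v c ∧
      IsAffinelyRegularPolygon m v

/-- There is an affinely regular polygon in `Λ` with `n` edges. -/
def HasAffinelyRegularPolygon (Λ : Set ℂ) (n : ℕ) : Prop :=
  ∃ v : ZMod n → ℂ, IsAffinelyRegularPolygon n v ∧ IsIn v Λ

end UPolygons

/-! ### Convex polygons and their parallel chords. -/

namespace UPolygons

open scoped ComplexConjugate

/-! With m = 2N, every condition is compared with (iii), that is, with ζ_N + ζ_N⁻¹ ∈ L.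

Necessity. If an edge e of a `U`-polygon has direction in `U`, convexity forces the chords in that
direction to join vertex i to vertex 2e + 1 - i, as in a regular polygon
(`IsConvexPolygon.parallel_of_edge`). Four consecutive such edges yield v(i+6) - v(i) = s (v(i+4) -
v(i+2)), where s is a cross ratio of the edge directions. The characteristic roots are 1, η, η⁻¹
with η + η⁻¹ = s - 1. As the shift i ↦ i + 2 has exact period N on the vertices, η is a primitive
N-th root of unity (`exists_isPrimitiveRoot_of_recurrence`). Directions from L give s ∈ L, and ζ_N
is a power of η. For (iv), a ratio of two parallel chords already gives ζ + ζ⁻¹.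

Sufficiency. An ℝ-linear map fixing 1 and sending a root of unity ζ to a non-real integer of L sends
all powers of ζ into the ring of integers, provided ζ + ζ⁻¹ ∈ L. Applied to a regular polygon this
gives (iv), and applied to the edge directions of the regular 2N-gon it gives (ii). The regular
2N-gon itself need not fit into Λ; for (i) it is replaced by the equiangular 2N-gon with edge
lengths alternating between 1 and 2 Re ζ_{2N}, which has the same edge directions.

Finiteness. Condition (iii) bounds φ(N) by 2[L : ℚ]. -/

lemma cross_sub_right (u z w : ℂ) : cross u (z - w) = cross u z - cross u w := by
  simp only [cross, Complex.sub_re, Complex.sub_im]; ring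

/-- The three-term Plücker relation. It propagates orientation along a polygon, and it is the linear
relation between the three coordinates of a point given by three directions. -/
lemma cross_plucker (a b c d : ℂ) :
    cross a c * cross b d = cross a b * cross c d + cross a d * cross b c := by
  simp only [cross]; ring

/-- In a convex polygon, vertices in cyclic order form positively oriented triangles. -/
lemma IsConvexPolygon.cross_pos {m : ℕ} {v : ZMod m → ℂ} (hv : IsConvexPolygon m v)
    (b : ZMod m) {j k : ℕ} (hj : 0 < j) (hjk : j < k) (hk : k < m) :
    0 < cross (v (b + j) - v b) (v (b + k) - v b) := by
  have cast_ne : ∀ x y : ℕ, x < m → y < m → x ≠ y → (x : ZMod m) ≠ y := by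
    intro x y hx hy hxy h
    rw [ZMod.natCast_eq_natCast_iff', Nat.mod_eq_of_lt hx, Nat.mod_eq_of_lt hy] at h
    exact hxy h
  have first : ∀ k : ℕ, 1 < k → k < m → 0 < cross (v (b + 1) - v b) (v (b + k) - v b) := by
    intro k h1 hk
    refine hv.2 b (b + k) ?_ ?_
    · intro h
      exact cast_ne k 0 hk (by omega) (by omega) (by simpa using h)
    · intro h
      exact cast_ne k 1 hk (by omega) (by omega) (by simpa using h)
  have succ : ∀ k : ℕ, 0 < k → k + 1 < m →
      0 < cross (v (b + k) - v b) (v (b + (k + 1 : ℕ)) - v b) := by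
    intro k h0 hk
    have := hv.2 (b + k) b ?_ ?_
    · convert this using 1
      simp only [cross, Complex.sub_re, Complex.sub_im]
      push_cast
      rw [← add_assoc]
      ring
    · intro h
      exact cast_ne k 0 (by omega) (by omega) (by omega) (by simpa using h)
    · intro h
      refine cast_ne (k + 1) 0 (by omega) (by omega) (by omega) ?_
      push_cast
      rw [add_assoc] at h
      simpa using h
  induction k, hjk using Nat.le_induction with
  | base => exact succ j hj hk
  | succ k hjk ih =>
    have ih := ih (by omega)
    rcases Nat.eq_or_lt_of_le hj with rfl | hj1
    · simpa using first (k + 1) (by omega) hk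
    · have hjj : 1 < j := hj1
      -- Seen from `v b`, the Plücker relation for the vertices 1, j, k, k + 1 has only positive
      -- terms on its right-hand side.
      have e := cross_plucker (v (b + 1) - v b) (v (b + j) - v b) (v (b + k) - v b)
        (v (b + (k + 1 : ℕ)) - v b)
      have h1 := first j hjj (by omega)
      have h2 := first k (by omega) (by omega)
      have h3 := first (k + 1) (by omega) hk
      have h4 := succ k (by omega) hk
      have : 0 < cross (v (b + 1) - v b) (v (b + k) - v b) *
          cross (v (b + j) - v b) (v (b + (k + 1 : ℕ)) - v b) := by
        rw [e]; positivity
      exact (mul_pos_iff_of_pos_left h2).1 this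

lemma IsConvexPolygon.cross_pos' {m : ℕ} {v : ZMod m → ℂ} (hv : IsConvexPolygon m v)
    (b : ZMod m) {i j k : ℕ} (hij : i < j) (hjk : j < k) (hk : k < m) :
    0 < cross (v (b + j) - v (b + i)) (v (b + k) - v (b + i)) := by
  have := hv.cross_pos (b + i) (j := j - i) (k := k - i) (by omega) (by omega) (by omega)
  rwa [add_assoc, add_assoc, ← Nat.cast_add, ← Nat.cast_add, Nat.add_sub_cancel' hij.le,
    Nat.add_sub_cancel' (hij.trans hjk).le] at this

/-- A chord separates the vertices strictly between its ends from the remaining ones. This lemma and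
the next two record the side as the sign of a difference of levels `cross u`; the factor `r`
accounts for the orientation of the chord relative to `u`. -/
lemma IsConvexPolygon.chord_between {m : ℕ} {v : ZMod m → ℂ} (hv : IsConvexPolygon m v)
    (b : ZMod m) {i j k : ℕ} {u : ℂ} {r : ℝ} (hr : v (b + k) - v (b + i) = r * u)
    (hij : i < j) (hjk : j < k) (hk : k < m) :
    r * (cross u (v (b + j)) - cross u (v (b + i))) < 0 := by
  have h := hv.cross_pos' b hij hjk hk
  rw [hr] at h
  simp only [cross, Complex.sub_re, Complex.sub_im, Complex.mul_re, Complex.mul_im,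
    Complex.ofReal_re, Complex.ofReal_im] at h ⊢
  linarith

lemma IsConvexPolygon.chord_after {m : ℕ} {v : ZMod m → ℂ} (hv : IsConvexPolygon m v)
    (b : ZMod m) {i j k : ℕ} {u : ℂ} {r : ℝ} (hr : v (b + k) - v (b + i) = r * u)
    (hik : i < k) (hkj : k < j) (hj : j < m) :
    0 < r * (cross u (v (b + j)) - cross u (v (b + i))) := by
  have h := hv.cross_pos' b hik hkj hj
  rw [hr] at h
  simp only [cross, Complex.sub_re, Complex.sub_im, Complex.mul_re, Complex.mul_im,
    Complex.ofReal_re, Complex.ofReal_im] at h ⊢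
  linarith

lemma IsConvexPolygon.chord_before {m : ℕ} {v : ZMod m → ℂ} (hv : IsConvexPolygon m v)
    (b : ZMod m) {i j k : ℕ} {u : ℂ} {r : ℝ} (hr : v (b + k) - v (b + i) = r * u)
    (hji : j < i) (hik : i < k) (hk : k < m) :
    0 < r * (cross u (v (b + j)) - cross u (v (b + i))) := by
  have h := hv.cross_pos' b hji hik hk
  rw [sub_eq_iff_eq_add] at hr
  rw [hr] at h
  simp only [cross, Complex.sub_re, Complex.sub_im, Complex.mul_re, Complex.mul_im,
    Complex.add_re, Complex.add_im, Complex.ofReal_re, Complex.ofReal_im] at h ⊢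
  linarith

lemma Parallel.cross_eq_zero {u w : ℂ} (h : Parallel u w) : cross u w = 0 := by
  obtain ⟨r, -, rfl⟩ := h
  simp [cross]; ring

lemma Parallel.neg {u w : ℂ} (h : Parallel u w) : Parallel u (-w) := by
  obtain ⟨r, hr, rfl⟩ := h
  exact ⟨-r, neg_ne_zero.2 hr, by push_cast; ring⟩

lemma Parallel.sub_comm {u z w : ℂ} (h : Parallel u (z - w)) : Parallel u (w - z) := by
  simpa using h.neg

/-- If a chord is parallel to `u`, so is the next one. -/
lemma IsConvexPolygon.parallel_next {m : ℕ} {v : ZMod m → ℂ} (hv : IsConvexPolygon m v)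
    {u : ℂ} (hu : ∀ i, ∃ j, j ≠ i ∧ Parallel u (v j - v i)) (b : ZMod m) {M : ℕ}
    (hM : 2 ≤ M) (hMm : M + 1 < m) (h0 : Parallel u (v (b + (M + 1 : ℕ)) - v b)) :
    Parallel u (v (b + M) - v (b + (1 : ℕ))) := by
  have : NeZero m := ⟨by omega⟩
  have partner : ∀ i < m, ∃ j < m, j ≠ i ∧ Parallel u (v (b + j) - v (b + i)) := by
    intro i hi
    obtain ⟨j, hj, hp⟩ := hu (b + i)
    refine ⟨(j - b).val, ZMod.val_lt _, ?_, by simpa using hp⟩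
    intro h
    apply hj
    rw [← h]; simp
  have heq : ∀ {i j : ℕ}, Parallel u (v (b + j) - v (b + i)) →
      cross u (v (b + j)) = cross u (v (b + i)) := by
    intro i j h
    have := h.cross_eq_zero
    rw [cross_sub_right] at this
    linarith
  have h0' : Parallel u (v (b + (M + 1 : ℕ)) - v (b + (0 : ℕ))) := by simpa using h0
  obtain ⟨r₀, hr₀, e₀⟩ := h0'
  -- The given chord separates 1, ..., M from the other vertices, so partners of vertices in this
  -- range stay in it.
  have side : ∀ i j : ℕ, 1 ≤ i → i ≤ M → j < m → cross u (v (b + j)) = cross u (v (b + i)) →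
      1 ≤ j ∧ j ≤ M := by
    intro i j hi1 hiM hj h
    have hi := hv.chord_between b e₀ (j := i) (by omega) (by omega) hMm
    rw [← h] at hi
    constructor
    · by_contra hj0
      obtain rfl : j = 0 := by omega
      simp at hi
    · by_contra hjM
      rcases Nat.eq_or_lt_of_le (show M + 1 ≤ j by omega) with rfl | hlt
      · rw [heq ⟨r₀, hr₀, e₀⟩] at hi
        simp at hi
      · exact absurd (hv.chord_after b e₀ (by omega) hlt hj) (not_lt.2 hi.le)
  obtain ⟨p, hp, hp1, hpp⟩ := partner 1 (by omega)
  obtain ⟨q, hq, hqM, hqq⟩ := partner M (by omega)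
  have sp := side 1 p le_rfl (by omega) hp (heq hpp)
  have sq := side M q (by omega) le_rfl hq (heq hqq)
  rcases Nat.eq_or_lt_of_le sp.2 with rfl | hpM
  · exact hpp
  rcases Nat.eq_or_lt_of_le sq.1 with rfl | hq1
  · exact hqq.sub_comm
  exfalso
  have ep := heq hpp
  have eq := heq hqq
  obtain ⟨r₁, hr₁, e₁⟩ := hpp
  obtain ⟨r₂, hr₂, e₂⟩ := hqq.sub_comm
  -- If p < q, the chords 0–(M+1), 1–p and q–M have three distinct levels, and for each level the
  -- other two lie on the same side; but one of three distinct reals lies between the others. If p =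
  -- q, three vertices are collinear. If q < p, the chord 1–p separates q from M, although these
  -- have equal levels.
  rcases lt_trichotomy p q with hpq | rfl | hpq
  · have a1 := hv.chord_between b e₀ (j := 1) (by omega) (by omega) hMm
    have a2 := hv.chord_between b e₀ (j := M) (by omega) (by omega) hMm
    have a3 := hv.chord_before b e₁ (j := 0) (by omega) (by omega) hp
    have a4 := hv.chord_after b e₁ (j := M) (by omega) (by omega) (by omega)
    have a5 := hv.chord_before b e₂ (j := 0) (by omega) (by omega) (by omega)
    have a6 := hv.chord_before b e₂ (j := 1) (by omega) (by omega) (by omega)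
    rw [eq] at a5 a6
    generalize cross u (v (b + (0 : ℕ))) = x at *
    generalize cross u (v (b + (1 : ℕ))) = y at *
    generalize cross u (v (b + (M : ℕ))) = z at *
    rw [mul_neg_iff] at a1 a2
    rw [mul_pos_iff] at a3 a4 a5 a6
    grind
  · have := hv.chord_after b e₁ (j := M) (by omega) hpM (by omega)
    rw [← eq, ep] at this
    simp at this
  · have a1 := hv.chord_between b e₁ (j := q) (by omega) (by omega) hp
    have a2 := hv.chord_after b e₁ (j := M) (by omega) (by omega) (by omega)
    rw [eq] at a1
    linarith

/-- The chords of a `U`-polygon parallel to an edge with direction in `U`. -/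
lemma IsConvexPolygon.parallel_of_edge {N : ℕ} {v : ZMod (2 * N) → ℂ}
    (hv : IsConvexPolygon (2 * N) v)
    {u : ℂ} (hu : ∀ i, ∃ j, j ≠ i ∧ Parallel u (v j - v i)) {e : ZMod (2 * N)}
    (he : Parallel u (v (e + 1) - v e)) (i : ZMod (2 * N)) :
    Parallel u (v i - v (2 * e + 1 - i)) := by
  have hm := hv.1
  have : NeZero (2 * N) := ⟨by omega⟩
  have hc : ((2 * N : ℕ) : ZMod (2 * N)) = 0 := ZMod.natCast_self _
  have key : ∀ k : ℕ, k < N → Parallel u (v (e + 1 + k) - v (e - k)) := by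
    intro k
    induction k with
    | zero => intro _; simpa using he
    | succ k ih =>
      intro hk
      have h := (ih (by omega)).sub_comm
      -- The arc runs from e + 1 + k around the polygon to e - k, which is M + 1 = 2N - 2k - 1
      -- steps.
      have := hv.parallel_next hu (e + 1 + k) (M := 2 * N - 2 * (k + 1)) (by omega) (by omega) ?_
      · refine (Parallel.sub_comm ?_)
        convert this using 3
        · rw [Nat.cast_sub (by omega), hc]; push_cast; ring
        · push_cast; ring
      · convert h using 3
        rw [Nat.cast_add, Nat.cast_sub (by omega), hc]; push_cast; ring
  by_cases hr : (i - (e + 1)).val < N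
  · have := key _ hr
    rw [ZMod.natCast_zmod_val] at this
    convert this using 3 <;> ring
  · have hlt := ZMod.val_lt (i - (e + 1))
    have := (key (2 * N - 1 - (i - (e + 1)).val) (by omega)).sub_comm
    rw [Nat.cast_sub (by omega), Nat.cast_sub (by omega), hc, ZMod.natCast_zmod_val] at this
    convert this using 3 <;> · push_cast; ring

end UPolygons
-- From four edge directions to a primitive root of unity.
namespace UPolygons

open scoped ComplexConjugate
open Polynomial

/-- A cubic recurrence with constant coefficients having a solution of exact period `N` comes
from a primitive `N`-th root of unity. -/
lemma exists_isPrimitiveRoot_of_recurrence {V : Type*} [AddCommGroup V] [Module ℂ V]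
    (T : Module.End ℂ V) (x : V) {N : ℕ} (hN : 2 ≤ N) (s : ℂ) (hT : (T ^ N) x = x)
    (hrec : (T ^ 3) x - x = s • ((T ^ 2) x - T x))
    (hper : ∀ d, 0 < d → d < N → (T ^ d) x ≠ x) :
    ∃ η : ℂ, IsPrimitiveRoot η N ∧ η + η⁻¹ = s - 1 := by
  -- The characteristic polynomial X³ - 1 - s(X² - X) factors as (X - 1)(X² - (s - 1)X + 1).
  obtain ⟨η, hη⟩ : ∃ η : ℂ, η ^ 2 - (s - 1) * η + 1 = 0 := by
    obtain ⟨η, hη⟩ := IsAlgClosed.exists_root (X ^ 2 - C (s - 1) * X + 1 : ℂ[X]) (by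
      have : (X ^ 2 - C (s - 1) * X + 1 : ℂ[X]).degree = 2 := by compute_degree!
      rw [this]; norm_num)
    exact ⟨η, by simpa [IsRoot] using hη⟩
  have hη0 : η ≠ 0 := by
    rintro rfl
    simp at hη
  have hsum : η + η⁻¹ = s - 1 := by
    field_simp
    linear_combination hη
  refine ⟨η, ?_, hsum⟩
  -- `d` is the order of η if η^N = 1, and 1 otherwise. In both cases every common root of the
  -- characteristic polynomial and X^N - 1 is a d-th root of unity. Since X^N - 1 is separable, the
  -- gcd divides X^d - 1, so T^d fixes `x`, which forces d = N.
  obtain ⟨d, hd0, hdN, hd⟩ : ∃ d : ℕ, 0 < d ∧ d ∣ N ∧ (η ^ N = 1 → η ^ d = 1) ∧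
      (d = N → IsPrimitiveRoot η N) := by
    by_cases h : η ^ N = 1
    · exact ⟨orderOf η, orderOf_pos_iff.2 (isOfFinOrder_iff_pow_eq_one.2 ⟨N, by omega, h⟩),
        orderOf_dvd_of_pow_eq_one h, fun _ ↦ pow_orderOf_eq_one η,
        fun h ↦ h ▸ IsPrimitiveRoot.orderOf η⟩
    · exact ⟨1, one_pos, one_dvd _, fun h' ↦ absurd h' h, fun h' ↦ by omega⟩
  set p : ℂ[X] := X ^ 3 - 1 - C s * (X ^ 2 - X) with hp
  set q : ℂ[X] := X ^ N - 1 with hq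
  have hp0 : aeval T p x = 0 := by
    simp only [hp, map_sub, map_mul, map_pow, aeval_X, aeval_C, map_one,
      LinearMap.sub_apply, Module.End.mul_apply, Module.End.one_apply]
    rw [hrec]
    simp [smul_sub]
  have hq0 : aeval T q x = 0 := by
    simp [hq, hT]
  set g := EuclideanDomain.gcd p q
  have hg0 : aeval T g x = 0 := by
    have : g = p * EuclideanDomain.gcdA p q + q * EuclideanDomain.gcdB p q :=
      EuclideanDomain.gcd_eq_gcd_ab p q
    rw [this, mul_comm p, mul_comm q]
    simp [hp0, hq0]
  have hqsep : q.Separable := X_pow_sub_one_separable_iff.2 (by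
    have : N ≠ 0 := by omega
    exact_mod_cast this)
  have hgp : g ∣ p := EuclideanDomain.gcd_dvd_left p q
  have hgq : g ∣ q := EuclideanDomain.gcd_dvd_right p q
  have hgsep : g.Separable := hqsep.of_dvd hgq
  have hdne : (X ^ d - 1 : ℂ[X]) ≠ 0 := X_pow_sub_C_ne_zero hd0 1
  have hgd : g ∣ X ^ d - 1 := by
    refine (IsAlgClosed.splits g).dvd_of_roots_le_roots hgsep.ne_zero ?_
    rw [Multiset.le_iff_subset (nodup_roots hgsep)]
    intro z hz
    have hz := isRoot_of_mem_roots hz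
    have h1 : z ^ 3 - 1 - s * (z ^ 2 - z) = 0 := by
      simpa [hp] using (hz.dvd hgp : p.eval z = 0)
    have h2 : z ^ N - 1 = 0 := by simpa [hq] using (hz.dvd hgq : q.eval z = 0)
    rw [mem_roots hdne]
    simp only [IsRoot, eval_sub, eval_pow, eval_X, eval_one]
    have h3 : (z - 1) * ((z - η) * (z - η⁻¹)) = 0 := by
      have : η * η⁻¹ = 1 := mul_inv_cancel₀ hη0
      linear_combination h1 - (z - 1) * z * hsum + (z - 1) * this
    rcases mul_eq_zero.1 h3 with h | h
    · rw [sub_eq_zero.1 h]; simp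
    · rcases mul_eq_zero.1 h with h | h
      · obtain rfl := sub_eq_zero.1 h
        rw [hd.1 (sub_eq_zero.1 h2), sub_self]
      · rw [sub_eq_zero.1 h] at h2 ⊢
        rw [inv_pow, hd.1, inv_one, sub_self]
        rwa [inv_pow, sub_eq_zero, inv_eq_one] at h2
  have hx : (T ^ d) x = x := by
    obtain ⟨k, hk⟩ := hgd
    have : aeval T (X ^ d - 1 : ℂ[X]) x = 0 := by
      rw [hk, mul_comm]; simp [hg0]
    simpa [sub_eq_zero] using this
  rcases (Nat.le_of_dvd (by omega) hdN).lt_or_eq with h | h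
  · exact absurd hx (hper d hd0 h)
  · exact hd.2 h

/-- The cross ratio of four consecutive edge directions of a polygon, all chords of which are
parallel in the same pattern as in a regular polygon. -/
lemma exists_isPrimitiveRoot_of_chords {N : ℕ} (hN : 4 ≤ N) {v : ZMod (2 * N) → ℂ}
    (hv : Function.Injective v) {d₀ d₁ d₂ d₃ : ℂ}
    (h₀ : ∀ i, cross d₀ (v i) = cross d₀ (v (1 - i)))
    (h₁ : ∀ i, cross d₁ (v i) = cross d₁ (v (3 - i)))
    (h₂ : ∀ i, cross d₂ (v i) = cross d₂ (v (5 - i)))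
    (h₃ : ∀ i, cross d₃ (v i) = cross d₃ (v (7 - i)))
    (c01 : cross d₀ d₁ ≠ 0) (c02 : cross d₀ d₂ ≠ 0) (c23 : cross d₂ d₃ ≠ 0) :
    ∃ η : ℂ, IsPrimitiveRoot η N ∧ η + η⁻¹ =
      ((cross d₁ d₂ / cross d₀ d₁ * (cross d₀ d₃ / cross d₂ d₃) : ℝ) : ℂ) - 1 := by
  have hm : ((2 * N : ℕ) : ZMod (2 * N)) = 0 := ZMod.natCast_self _
  let T : Module.End ℂ (ZMod (2 * N) → ℂ) := LinearMap.funLeft ℂ ℂ fun i ↦ i + 2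
  have hT : ∀ (k : ℕ) (f : ZMod (2 * N) → ℂ) (i : ZMod (2 * N)),
      (T ^ k) f i = f (i + 2 * k) := by
    intro k
    induction k with
    | zero => simp
    | succ k ih =>
      intro f i
      rw [pow_succ, Module.End.mul_apply, ih]
      simp only [T, LinearMap.funLeft_apply]
      congr 1
      push_cast; ring
  refine exists_isPrimitiveRoot_of_recurrence T v (by omega) _ ?_ ?_ ?_
  · ext i
    rw [hT]
    have : (2 * N : ZMod (2 * N)) = 0 := by exact_mod_cast hm
    rw [this, add_zero]
  · set s := cross d₁ d₂ / cross d₀ d₁ * (cross d₀ d₃ / cross d₂ d₃) with hs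
    have hs' : s * cross d₀ d₁ * cross d₂ d₃ = cross d₁ d₂ * cross d₀ d₃ := by
      rw [hs]; field_simp
    ext i
    have e1 : ∀ f, T f i = f (i + 2) := fun f ↦ rfl
    simp only [Pi.sub_apply, Pi.smul_apply, smul_eq_mul, hT, e1]
    -- Subtract the relations between the d₀-, d₁- and d₂-coordinates at j + 4 and at its d₂-mirror
    -- 1 - j. The d₂-terms cancel, and the d₀- and d₁-mirrors of 1 - j are j and j + 2.
    have hA : ∀ j, cross d₁ d₂ * (cross d₀ (v (j + 4)) - cross d₀ (v j)) =
        cross d₀ d₂ * (cross d₁ (v (j + 4)) - cross d₁ (v (j + 2))) := by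
      intro j
      have a := h₂ (j + 4)
      have b := h₀ (5 - (j + 4))
      have c := h₁ (5 - (j + 4))
      rw [show 1 - (5 - (j + 4)) = j by ring] at b
      rw [show 3 - (5 - (j + 4)) = j + 2 by ring] at c
      have p1 := cross_plucker d₀ d₁ d₂ (v (j + 4))
      have p2 := cross_plucker d₀ d₁ d₂ (v (5 - (j + 4)))
      rw [← a, b, c] at p2
      linear_combination p2 - p1
    have hB : ∀ j, cross d₁ d₃ * (cross d₀ (v (j + 6)) - cross d₀ (v j)) =
        cross d₀ d₃ * (cross d₁ (v (j + 6)) - cross d₁ (v (j + 2))) := by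
      intro j
      have a := h₃ (j + 6)
      have b := h₀ (7 - (j + 6))
      have c := h₁ (7 - (j + 6))
      rw [show 1 - (7 - (j + 6)) = j by ring] at b
      rw [show 3 - (7 - (j + 6)) = j + 2 by ring] at c
      have p1 := cross_plucker d₀ d₁ d₃ (v (j + 6))
      have p2 := cross_plucker d₀ d₁ d₃ (v (7 - (j + 6)))
      rw [← a, b, c] at p2
      linear_combination p2 - p1
    have hpl := cross_plucker d₀ d₁ d₂ d₃
    -- The d₁-coordinates are eliminated from `hA j`, `hA (j + 2)` and `hB j`; the relation `hpl`
    -- between the four directions leaves the factor s.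
    have hX : ∀ j, cross d₀ (v (j + 6)) - cross d₀ (v j) =
        s * (cross d₀ (v (j + 4)) - cross d₀ (v (j + 2))) := by
      intro j
      have a := hA j
      have b := hA (j + 2)
      rw [show j + 2 + 4 = j + 6 by ring, show j + 2 + 2 = j + 4 by ring] at b
      have c := hB j
      refine mul_left_cancel₀ (mul_ne_zero c01 c23) ?_
      linear_combination (-(cross d₀ (v (j + 6)) - cross d₀ (v j))) * hpl +
        cross d₀ d₂ * c - cross d₀ d₃ * (a + b) -
        (cross d₀ (v (j + 4)) - cross d₀ (v (j + 2))) * hs'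
    have hY : ∀ j, cross d₁ (v (j + 6)) - cross d₁ (v j) =
        s * (cross d₁ (v (j + 4)) - cross d₁ (v (j + 2))) := by
      intro j
      have a := hA (j - 2)
      have b := hA j
      have c := hA (j + 2)
      have x0 := hX j
      have x1 := hX (j - 2)
      rw [show j - 2 + 4 = j + 2 by ring, show j - 2 + 2 = j by ring] at a
      rw [show j - 2 + 6 = j + 4 by ring, show j - 2 + 4 = j + 2 by ring,
        show j - 2 + 2 = j by ring] at x1
      rw [show j + 2 + 4 = j + 6 by ring, show j + 2 + 2 = j + 4 by ring] at c
      refine mul_left_cancel₀ c02 ?_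
      linear_combination s * b - a - b - c + cross d₁ d₂ * (x0 + x1)
    have hx := hX i
    have hy := hY i
    -- d₀ and d₁ are independent, so the recurrences of these two coordinates give that of the
    -- vertices.
    have inj : ∀ z : ℂ, cross d₀ z = 0 → cross d₁ z = 0 → z = 0 := by
      intro z hz0 hz1
      simp only [cross] at hz0 hz1 c01
      apply Complex.ext
      · refine mul_left_cancel₀ c01 ?_
        simp only [Complex.zero_re]
        linear_combination d₁.re * hz0 - d₀.re * hz1
      · refine mul_left_cancel₀ c01 ?_
        simp only [Complex.zero_im]
        linear_combination d₁.im * hz0 - d₀.im * hz1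
    have lin : ∀ u : ℂ, cross u ((v (i + 6) - v i) - s * (v (i + 4) - v (i + 2))) =
        cross u (v (i + 6)) - cross u (v i) - s * (cross u (v (i + 4)) - cross u (v (i + 2))) := by
      intro u
      simp [cross]; ring
    have := inj _ ((lin d₀).trans (by rw [hx]; ring)) ((lin d₁).trans (by rw [hy]; ring))
    push_cast
    norm_num
    exact sub_eq_zero.1 this
  · intro d hd hdN h
    have h0 := congrFun h 0
    rw [hT] at h0
    have h1 := hv h0
    have : ((2 * d : ℕ) : ZMod (2 * N)) = 0 := by push_cast; simpa using h1
    rw [ZMod.natCast_eq_zero_iff] at this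
    have := Nat.le_of_dvd (by omega) this
    omega

lemma IsConvexPolygon.injective {m : ℕ} {v : ZMod m → ℂ} (hv : IsConvexPolygon m v) :
    Function.Injective v := by
  intro i j h
  by_contra hij
  have hz : cross (v (i + 1) - v i) 0 = 0 := by simp [cross]
  by_cases hj : j = i + 1
  · have hm := hv.1
    have := hv.2 i (i + 2) ?_ ?_
    · rw [← hj, ← h] at this
      simp [cross] at this
    · intro h'
      have : ((2 : ℕ) : ZMod m) = 0 := by simpa using h'
      rw [ZMod.natCast_eq_zero_iff] at this
      have := Nat.le_of_dvd (by omega) this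
      omega
    · intro h'
      have : ((1 : ℕ) : ZMod m) = 0 := by
        have : (2 : ZMod m) = 1 := by simpa using h'
        push_cast
        linear_combination this
      rw [ZMod.natCast_eq_zero_iff] at this
      have := Nat.le_of_dvd (by omega) this
      omega
  · have := hv.2 i j (fun h' ↦ hij h'.symm) hj
    rw [← h, sub_self, hz] at this
    exact lt_irrefl _ this

lemma Parallel.cross_eq_zero_right {u w d : ℂ} (h : Parallel u w) (hd : Parallel u d) :
    cross d w = 0 := by
  obtain ⟨r, -, rfl⟩ := h
  obtain ⟨r', -, rfl⟩ := hd
  simp [cross]; ring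

lemma IsConvexPolygon.shift {m : ℕ} {v : ZMod m → ℂ} (hv : IsConvexPolygon m v) (e : ZMod m) :
    IsConvexPolygon m fun i ↦ v (e + i) := by
  refine ⟨hv.1, fun i j h1 h2 ↦ ?_⟩
  have := hv.2 (e + i) (e + j) (by simpa using h1) (by rw [add_assoc]; simpa using h2)
  rwa [add_assoc] at this

/-- If four consecutive edges of a `U`-polygon with `2 * N` edges have directions in `U`, then the
cross ratio of these directions is that of consecutive edges of a regular polygon. -/
lemma IsUPolygon.exists_isPrimitiveRoot {U : Finset Circle} {N : ℕ} (hN : 4 ≤ N)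
    {v : ZMod (2 * N) → ℂ} (hv : IsUPolygon U (2 * N) v) (e : ZMod (2 * N)) (u : ℕ → Circle)
    (hu : ∀ k < 4, u k ∈ U) (hue : ∀ k < 4, Parallel (u k) (v (e + k + 1) - v (e + k)))
    (d : ℕ → ℂ) (hd : ∀ k < 4, Parallel (u k) (d k)) :
    cross (d 0) (d 1) ≠ 0 ∧ cross (d 2) (d 3) ≠ 0 ∧
    ∃ η : ℂ, IsPrimitiveRoot η N ∧ η + η⁻¹ =
      ((cross (d 1) (d 2) / cross (d 0) (d 1) * (cross (d 0) (d 3) / cross (d 2) (d 3)) : ℝ) :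
        ℂ) - 1 := by
  obtain ⟨-, hconv, hline⟩ := hv
  set w : ZMod (2 * N) → ℂ := fun i ↦ v (e + i) with hw
  have wconv : IsConvexPolygon (2 * N) w := hconv.shift e
  have hpair : ∀ k < 4, ∀ i, Parallel (u k) (w i - w (2 * k + 1 - i)) := by
    intro k hk i
    refine wconv.parallel_of_edge (e := k) (fun i ↦ ?_) ?_ i
    · obtain ⟨j, hj, hp⟩ := hline (e + i) (u k) (hu k hk)
      refine ⟨j - e, fun h ↦ hj (by rw [← h]; ring), ?_⟩
      simpa [hw] using hp
    · have := hue k hk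
      simpa only [hw, add_assoc] using this
  have hd0 : ∀ k < 4, ∀ z, cross (d k) z = 0 → cross (u k) z = 0 := by
    intro k hk z hz
    obtain ⟨r, hr, e⟩ := hd k hk
    rw [e] at hz
    have : cross (r * u k) z = r * cross (u k) z := by simp [cross]; ring
    rw [this] at hz
    exact (mul_eq_zero.1 hz).resolve_left hr
  have hch : ∀ k < 4, ∀ i, cross (d k) (w i) = cross (d k) (w (2 * k + 1 - i)) := by
    intro k hk i
    have := (hpair k hk i).cross_eq_zero_right (hd k hk)
    rw [cross_sub_right] at this
    linarith
  -- Two chords from a common vertex that span a triangle certify that their directions are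
  -- independent.
  have hne : ∀ k l : ℕ, k < 4 → l < 4 → ∀ i j z : ZMod (2 * N), Parallel (u k) (w j - w i) →
      Parallel (u l) (w z - w i) → cross (w j - w i) (w z - w i) ≠ 0 →
      cross (d k) (d l) ≠ 0 := by
    intro k l hk hl i j z h1 h2 h3 h4
    apply h3
    obtain ⟨r1, hr1, e1⟩ := h1
    obtain ⟨r2, hr2, e2⟩ := h2
    obtain ⟨r3, hr3, e3⟩ := hd k hk
    obtain ⟨r4, hr4, e4⟩ := hd l hl
    rw [e3, e4] at h4
    rw [e1, e2]
    have h5 : (r3 * r4) * cross (u k) (u l) = 0 := by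
      rw [← h4]; simp [cross]; ring
    have h6 := (mul_eq_zero.1 h5).resolve_left (mul_ne_zero hr3 hr4)
    have : cross (r1 * u k) (r2 * u l) = (r1 * r2) * cross (u k) (u l) := by
      simp [cross]; ring
    rw [this, h6, mul_zero]
  have c01 : cross (d 0) (d 1) ≠ 0 := by
    refine hne 0 1 (by norm_num) (by norm_num) 1 0 2 ?_ ?_ ?_
    · simpa using hpair 0 (by norm_num) 0
    · convert hpair 1 (by norm_num) 2 using 3; push_cast; ring
    · have := wconv.cross_pos 0 (j := 1) (k := 2) (by omega) (by omega) (by omega)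
      simp only [zero_add, Nat.cast_one, Nat.cast_ofNat] at this
      rw [show cross (w 0 - w 1) (w 2 - w 1) = - cross (w 1 - w 0) (w 2 - w 0) by
        simp [cross]; ring]
      exact (neg_neg_of_pos this).ne
  -- The edges 0 and 2 have no common vertex, but the chord from 0 to 5 is parallel to edge 2.
  have c02 : cross (d 0) (d 2) ≠ 0 := by
    refine hne 0 2 (by norm_num) (by norm_num) 0 1 5 ?_ ?_ ?_
    · simpa using hpair 0 (by norm_num) 1
    · convert hpair 2 (by norm_num) 5 using 3; push_cast; ring
    · have := wconv.cross_pos 0 (j := 1) (k := 5) (by omega) (by omega) (by omega)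
      simp only [zero_add, Nat.cast_one, Nat.cast_ofNat] at this
      exact this.ne'
  have c23 : cross (d 2) (d 3) ≠ 0 := by
    refine hne 2 3 (by norm_num) (by norm_num) 3 2 4 ?_ ?_ ?_
    · convert hpair 2 (by norm_num) 2 using 3; push_cast; ring
    · convert hpair 3 (by norm_num) 4 using 3; push_cast; ring
    · have := wconv.cross_pos' 0 (i := 2) (j := 3) (k := 4) (by omega) (by omega) (by omega)
      simp only [zero_add, Nat.cast_ofNat] at this
      rw [show cross (w 2 - w 3) (w 4 - w 3) = - cross (w 3 - w 2) (w 4 - w 2) by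
        simp [cross]; ring]
      exact (neg_neg_of_pos this).ne
  refine ⟨c01, c23, exists_isPrimitiveRoot_of_chords hN wconv.injective ?_ ?_ ?_ ?_ c01 c02 c23⟩
  · intro i; convert hch 0 (by norm_num) i using 4; push_cast; ring
  · intro i; convert hch 1 (by norm_num) i using 4; push_cast; ring
  · intro i; convert hch 2 (by norm_num) i using 4; push_cast; ring
  · intro i; convert hch 3 (by norm_num) i using 4; push_cast; ring

end UPolygons
namespace UPolygons

open scoped ComplexConjugate
open Real

/-! ### Roots of unity and their real parts. -/

section RootsOfUnity

lemma isPrimitiveRoot_zeta {n : ℕ} (hn : n ≠ 0) : IsPrimitiveRoot (zeta n) n :=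
  Complex.isPrimitiveRoot_exp n hn

lemma zeta_eq (n : ℕ) : zeta n = Complex.exp ((2 * π / n : ℝ) * Complex.I) := by
  rw [zeta]; congr 1; push_cast; ring

lemma zeta_pow (n k : ℕ) : zeta n ^ k = Complex.exp ((2 * π * k / n : ℝ) * Complex.I) := by
  rw [zeta_eq, ← Complex.exp_nat_mul]; congr 1; push_cast; ring

lemma zeta_pow_re (n k : ℕ) : (zeta n ^ k).re = cos (2 * π * k / n) := by
  rw [zeta_pow, Complex.exp_ofReal_mul_I_re]

lemma zeta_pow_im (n k : ℕ) : (zeta n ^ k).im = sin (2 * π * k / n) := by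
  rw [zeta_pow, Complex.exp_ofReal_mul_I_im]

lemma zeta_pow_im_pos {n k : ℕ} (hk : 0 < k) (hkn : 2 * k < n) : 0 < (zeta n ^ k).im := by
  have hn : (0 : ℝ) < n := by exact_mod_cast (by omega : 0 < n)
  have hk' : (0 : ℝ) < k := by exact_mod_cast hk
  rw [zeta_pow_im]
  apply sin_pos_of_pos_of_lt_pi
  · positivity
  · rw [div_lt_iff₀ hn]
    have : (2 * k : ℝ) < n := by exact_mod_cast hkn
    nlinarith [pi_pos]

lemma zeta_im_pos {n : ℕ} (hn : 3 ≤ n) : 0 < (zeta n).im := by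
  simpa using zeta_pow_im_pos (n := n) (k := 1) one_pos (by omega)

lemma zeta_re_pos {n : ℕ} (hn : 5 ≤ n) : 0 < (zeta n).re := by
  have h := zeta_pow_re n 1
  rw [pow_one] at h
  rw [h]
  have hn' : (5 : ℝ) ≤ n := by exact_mod_cast hn
  have hn0 : (0 : ℝ) < n := by linarith
  apply cos_pos_of_mem_Ioo
  have : 2 * π * (1 : ℕ) / n < π / 2 := by
    rw [div_lt_iff₀ hn0]; push_cast; nlinarith [pi_pos]
  have : 0 < 2 * π * (1 : ℕ) / n := by push_cast; positivity
  constructor <;> linarith [pi_pos]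

lemma norm_zeta (n : ℕ) : ‖zeta n‖ = 1 := by
  rw [zeta_eq, Complex.norm_exp_ofReal_mul_I]

lemma conj_zeta (n : ℕ) : conj (zeta n) = (zeta n)⁻¹ :=
  (Complex.inv_eq_conj (norm_zeta n)).symm

lemma zeta_ne_zero (n : ℕ) : zeta n ≠ 0 := Complex.exp_ne_zero _

lemma zeta_add_inv (n : ℕ) : zeta n + (zeta n)⁻¹ = ((2 * (zeta n).re : ℝ) : ℂ) := by
  rw [← conj_zeta, Complex.add_conj]

lemma zeta_re_lt_one {m : ℕ} (hm : 2 ≤ m) : (zeta m).re < 1 := by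
  have h := zeta_pow_re m 1
  rw [pow_one] at h
  rw [h]
  have hm' : (2 : ℝ) ≤ m := by exact_mod_cast hm
  have hm0 : (0 : ℝ) < m := by linarith
  have := cos_lt_cos_of_nonneg_of_le_pi (x := 0) (y := 2 * π * (1 : ℕ) / m) le_rfl
    (by rw [div_le_iff₀ hm0]; push_cast; nlinarith [pi_pos])
    (by push_cast; have := pi_pos; positivity)
  simpa using this

variable {m : ℕ} [NeZero m]

lemma stdAddChar_natCast (k : ℕ) : ZMod.stdAddChar (k : ZMod m) = zeta m ^ k := by
  have := ZMod.stdAddChar_coe (N := m) (k : ℤ)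
  rw [Int.cast_natCast] at this
  rw [this, zeta_pow]
  congr 1; push_cast; ring

lemma stdAddChar_one : ZMod.stdAddChar (1 : ZMod m) = zeta m := by
  simpa using stdAddChar_natCast (m := m) 1

lemma conj_stdAddChar (k : ZMod m) : conj (ZMod.stdAddChar k) = ZMod.stdAddChar (-k) := by
  rw [AddChar.map_neg_eq_conj]

lemma stdAddChar_neg_re (k : ZMod m) : (ZMod.stdAddChar (-k)).re = (ZMod.stdAddChar k).re := by
  rw [← conj_stdAddChar, Complex.conj_re]

lemma stdAddChar_re_le {k : ZMod m} (hk : k ≠ 0) :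
    (ZMod.stdAddChar k).re ≤ (zeta m).re := by
  have hm0 : (0 : ℝ) < m := by exact_mod_cast NeZero.pos m
  have key : ∀ k : ℕ, 0 < k → 2 * k ≤ m → (zeta m ^ k).re ≤ (zeta m).re := by
    intro k h1 h2
    have h1' : (1 : ℝ) ≤ k := by exact_mod_cast h1
    have h2' : (2 * k : ℝ) ≤ m := by exact_mod_cast h2
    have h3 := zeta_pow_re m 1
    rw [pow_one] at h3
    rw [zeta_pow_re, h3]
    apply cos_le_cos_of_nonneg_of_le_pi
    · push_cast; positivity
    · rw [div_le_iff₀ hm0]; nlinarith [pi_pos]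
    · gcongr
      exact_mod_cast h1
  have hlt := ZMod.val_lt k
  have h0 : 0 < k.val := ZMod.val_pos.2 hk
  by_cases h : 2 * k.val ≤ m
  · have := key k.val h0 h
    rwa [← stdAddChar_natCast, ZMod.natCast_zmod_val] at this
  · have := key (m - k.val) (by omega) (by omega)
    rwa [← stdAddChar_natCast, Nat.cast_sub hlt.le, ZMod.natCast_zmod_val, ZMod.natCast_self,
      zero_sub, stdAddChar_neg_re] at this

end RootsOfUnity

/-! ### Equiangular polygons with alternating edge lengths. -/

section TwoStepPolygon

/-- The function with value `1` on even and `ρ` on odd residues. -/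
def alternating (N : ℕ) (ρ : ℝ) (i : ZMod (2 * N)) : ℝ :=
  if ZMod.castHom (Dvd.intro N rfl : 2 ∣ 2 * N) (ZMod 2) i = 0 then 1 else ρ

/-- The vertices of the equiangular polygon with `2 * N` edges, the lengths of which are
alternatingly `1` and `ρ`. -/
noncomputable def twoStep (N : ℕ) [NeZero N] (ρ : ℝ) (i : ZMod (2 * N)) : ℂ :=
  -- With e_i the desired edge vectors, e_{i+2} = ζ² e_i, so (e_i + e_{i+1}) / (ζ² - 1) has
  -- difference e_i and closes up automatically.
  (alternating N ρ i * ZMod.stdAddChar i + alternating N ρ (i + 1) * ZMod.stdAddChar (i + 1)) /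
    (zeta (2 * N) ^ 2 - 1)

variable {N : ℕ} {ρ : ℝ}

lemma alternating_pos (hρ : 0 < ρ) (i : ZMod (2 * N)) : 0 < alternating N ρ i := by
  unfold alternating; split_ifs <;> simp [hρ]

lemma alternating_congr {i j : ZMod (2 * N)} (h : ∃ k, j = i + 2 * k) :
    alternating N ρ j = alternating N ρ i := by
  obtain ⟨k, rfl⟩ := h
  simp only [alternating, map_add, map_mul, map_ofNat]
  rw [show (2 : ZMod 2) = 0 by decide, zero_mul, add_zero]

lemma alternating_cases (i j : ZMod (2 * N)) :
    (alternating N ρ j = alternating N ρ i ∧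
      alternating N ρ (j + 1) = alternating N ρ (i + 1)) ∨
    (alternating N ρ j = alternating N ρ (i + 1) ∧
      alternating N ρ (j + 1) = alternating N ρ i) := by
  simp only [alternating, map_add, map_one]
  generalize ZMod.castHom (Dvd.intro N rfl : 2 ∣ 2 * N) (ZMod 2) i = a
  generalize ZMod.castHom (Dvd.intro N rfl : 2 ∣ 2 * N) (ZMod 2) j = b
  have : ∀ a b : ZMod 2, b = a ∨ b = a + 1 := by decide
  rcases this a b with rfl | rfl
  · left; simp
  · right
    rw [add_assoc, show (1 + 1 : ZMod 2) = 0 by decide, add_zero]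
    simp

lemma alternating_natCast (k : ℕ) :
    alternating N ρ (k : ZMod (2 * N)) = if Even k then 1 else ρ := by
  simp only [alternating, map_natCast, ZMod.natCast_eq_zero_iff, even_iff_two_dvd]

variable [NeZero N]

lemma zeta_sq_sub_one (n : ℕ) :
    zeta n ^ 2 - 1 = zeta n * ((2 * (zeta n).im : ℝ) * Complex.I) := by
  rw [← Complex.sub_conj, conj_zeta, mul_sub, mul_inv_cancel₀ (zeta_ne_zero n), sq]

lemma zeta_sq_ne_one {n : ℕ} (hn : 3 ≤ n) : zeta n ^ 2 - 1 ≠ 0 := by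
  rw [zeta_sq_sub_one]
  have := (zeta_im_pos hn).ne'
  simp [zeta_ne_zero, this]

lemma twoStep_edge (hN : 2 ≤ N) (i : ZMod (2 * N)) :
    twoStep N ρ (i + 1) - twoStep N ρ i = alternating N ρ i * ZMod.stdAddChar i := by
  have h := zeta_sq_ne_one (n := 2 * N) (by omega)
  rw [twoStep, twoStep, alternating_congr (i := i) (j := i + 1 + 1) ⟨1, by ring⟩,
    AddChar.map_add_eq_mul _ (i + 1) 1, AddChar.map_add_eq_mul _ i 1, stdAddChar_one]
  field_simp
  ring

/-- As ζ² - 1 is ζ times 2i Im ζ, the cross product becomes a real part. The substitution j ↦ 2k + 1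
- j exchanges the two summands on the right, which is the source of the parallel chords. -/
lemma cross_twoStep (hN : 2 ≤ N) (k j : ZMod (2 * N)) :
    2 * (zeta (2 * N)).im * cross (ZMod.stdAddChar k) (twoStep N ρ j) =
      -(alternating N ρ j * (ZMod.stdAddChar (j - k - 1)).re +
        alternating N ρ (j + 1) * (ZMod.stdAddChar (j - k)).re) := by
  have h := zeta_sq_ne_one (n := 2 * N) (by omega)
  have hz := zeta_ne_zero (2 * N)
  have e : ((2 * (zeta (2 * N)).im : ℝ) * Complex.I) *
      (conj (ZMod.stdAddChar k) * twoStep N ρ j) =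
      alternating N ρ j * ZMod.stdAddChar (j - k - 1) +
        alternating N ρ (j + 1) * ZMod.stdAddChar (j - k) := by
    have h1 : ZMod.stdAddChar (j - k - 1) =
        ZMod.stdAddChar (-k) * ZMod.stdAddChar j * (zeta (2 * N))⁻¹ := by
      rw [← stdAddChar_one (m := 2 * N), ← AddChar.map_neg_eq_inv, ← AddChar.map_add_eq_mul,
        ← AddChar.map_add_eq_mul]
      congr 1; ring
    have h2 : ZMod.stdAddChar (j - k) =
        ZMod.stdAddChar (-k) * ZMod.stdAddChar (j + 1) * (zeta (2 * N))⁻¹ := by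
      rw [← stdAddChar_one (m := 2 * N), ← AddChar.map_neg_eq_inv, ← AddChar.map_add_eq_mul,
        ← AddChar.map_add_eq_mul]
      congr 1; ring
    rw [h1, h2, conj_stdAddChar, twoStep]
    have h3 := zeta_sq_sub_one (2 * N)
    rw [h3] at h ⊢
    have h4 := (mul_ne_zero_iff.1 h).2
    generalize ((2 * (zeta (2 * N)).im : ℝ) : ℂ) * Complex.I = t at *
    field_simp
  have := congrArg Complex.re e
  simp only [Complex.add_re, Complex.mul_re, Complex.mul_im, Complex.ofReal_re,
    Complex.ofReal_im, Complex.I_re, Complex.I_im, Complex.conj_re, Complex.conj_im] at this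
  simp only [cross]
  linarith

/-- Each edge lies on a supporting line: in `cross_twoStep` one of the real parts is 1 at j = i,
whereas both are at most Re ζ < 1 if j is not an end of the edge. -/
lemma twoStep_isConvexPolygon (hN : 2 ≤ N) (hρ : 0 < ρ) :
    IsConvexPolygon (2 * N) (twoStep N ρ) := by
  refine ⟨by omega, fun i j hji hji1 ↦ ?_⟩
  have him := zeta_im_pos (n := 2 * N) (by omega)
  have hlt := zeta_re_lt_one (m := 2 * N) (by omega)
  rw [twoStep_edge hN]
  have e : cross (alternating N ρ i * ZMod.stdAddChar i) (twoStep N ρ j - twoStep N ρ i) =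
      alternating N ρ i * (cross (ZMod.stdAddChar i) (twoStep N ρ j) -
        cross (ZMod.stdAddChar i) (twoStep N ρ i)) := by
    simp [cross]; ring
  rw [e]
  have pi' := alternating_pos hρ i
  have pi1 := alternating_pos hρ (i + 1)
  refine mul_pos pi' ?_
  have ej := cross_twoStep (ρ := ρ) hN i j
  have ei := cross_twoStep (ρ := ρ) hN i i
  have h1 : (ZMod.stdAddChar (i - i - 1)).re = (zeta (2 * N)).re := by
    rw [sub_self, zero_sub, stdAddChar_neg_re, stdAddChar_one]
  have h2 : (ZMod.stdAddChar (i - i)).re = 1 := by simp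
  rw [h1, h2] at ei
  have a1 := stdAddChar_re_le (k := j - i) (sub_ne_zero.2 hji)
  have a2 := stdAddChar_re_le (k := j - i - 1)
    (by rw [sub_sub]; exact sub_ne_zero.2 hji1)
  have : 0 < 2 * (zeta (2 * N)).im * (cross (ZMod.stdAddChar i) (twoStep N ρ j) -
        cross (ZMod.stdAddChar i) (twoStep N ρ i)) := by
    rw [mul_sub, ej, ei]
    rcases alternating_cases (ρ := ρ) i j with ⟨h3, h4⟩ | ⟨h3, h4⟩ <;> rw [h3, h4] <;> nlinarith
  exact (mul_pos_iff_of_pos_left (by positivity)).1 this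

lemma parallel_of_cross_eq_zero {u w : ℂ} (hu : u ≠ 0) (hw : w ≠ 0) (h : cross u w = 0) :
    Parallel u w := by
  have hr : w = ((w / u).re : ℂ) * u := by
    have him : (w / u).im = 0 := by
      rw [Complex.div_im]
      simp only [cross] at h
      rw [← sub_div, show w.im * u.re - w.re * u.im = 0 by linarith, zero_div]
    rw [show (((w / u).re : ℝ) : ℂ) = w / u from Complex.ext rfl (by simp [him])]
    field_simp
  refine ⟨_, ?_, hr⟩
  intro h0
  rw [h0] at hr
  exact hw (by simpa using hr)

lemma twoStep_chord (hN : 2 ≤ N) (hρ : 0 < ρ) (k i : ZMod (2 * N)) :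
    ∃ j, j ≠ i ∧ Parallel (ZMod.stdAddChar k) (twoStep N ρ j - twoStep N ρ i) := by
  have hne : 2 * k + 1 - i ≠ i := by
    intro h
    have h' : (1 : ZMod (2 * N)) = 2 * (i - k) := by linear_combination h
    have := congrArg (ZMod.castHom (Dvd.intro N rfl : 2 ∣ 2 * N) (ZMod 2)) h'
    simp only [map_one, map_mul, map_ofNat] at this
    rw [show (2 : ZMod 2) = 0 by decide, zero_mul] at this
    exact absurd this (by decide)
  refine ⟨2 * k + 1 - i, hne, parallel_of_cross_eq_zero (AddChar.val_isUnit _ _).ne_zero ?_ ?_⟩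
  · exact sub_ne_zero.2 fun h ↦ hne ((twoStep_isConvexPolygon hN hρ).injective h)
  · have him := zeta_im_pos (n := 2 * N) (by omega)
    have ej := cross_twoStep (ρ := ρ) hN k (2 * k + 1 - i)
    have ei := cross_twoStep (ρ := ρ) hN k i
    rw [alternating_congr (i := i + 1) (j := 2 * k + 1 - i) ⟨k - i, by ring⟩,
      alternating_congr (i := i) (j := 2 * k + 1 - i + 1) ⟨k + 1 - i, by ring⟩,
      show 2 * k + 1 - i - k - 1 = -(i - k) by ring, stdAddChar_neg_re,
      show 2 * k + 1 - i - k = -(i - k - 1) by ring, stdAddChar_neg_re] at ej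
    rw [cross_sub_right]
    have : 2 * (zeta (2 * N)).im ≠ 0 := by positivity
    refine mul_left_cancel₀ this ?_
    linear_combination ej - ei

lemma twoStep_one_isRegularPolygon (hN : 2 ≤ N) : IsRegularPolygon (2 * N) (twoStep N 1) := by
  have h := zeta_sq_ne_one (n := 2 * N) (by omega)
  have h' : (zeta (2 * N) - 1) * (zeta (2 * N) + 1) ≠ 0 := by convert h using 1; ring
  obtain ⟨h1, h2⟩ := mul_ne_zero_iff.1 h'
  refine ⟨by omega, 0, (zeta (2 * N) - 1)⁻¹, inv_ne_zero h1, fun i ↦ ?_⟩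
  rw [← stdAddChar_natCast, ZMod.natCast_zmod_val, twoStep, AddChar.map_add_eq_mul,
    stdAddChar_one, show zeta (2 * N) ^ 2 - 1 = (zeta (2 * N) - 1) * (zeta (2 * N) + 1) by ring]
  simp only [alternating, ite_self, Complex.ofReal_one]
  field_simp
  ring

end TwoStepPolygon

/-! ### Linear images of these polygons. -/

section Shear

/-- The linear map of the plane which fixes `1` and maps `i` to `σ`. -/
def shear (σ : ℂ) : ℂ →ₗ[ℝ] ℂ where
  toFun z := z.re + z.im * σ
  map_add' z w := by simp; ring
  map_smul' r z := by simp; ring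

lemma shear_apply (σ z : ℂ) : shear σ z = z.re + z.im * σ := rfl

lemma shear_mul (σ : ℂ) (r : ℝ) (z : ℂ) : shear σ (r * z) = r * shear σ z := by
  simpa using (shear σ).map_smul r z

lemma cross_shear (σ z w : ℂ) : cross (shear σ z) (shear σ w) = σ.im * cross z w := by
  simp [cross, shear_apply]; ring

lemma shear_eq_zero {σ : ℂ} (hσ : σ.im ≠ 0) {z : ℂ} (h : shear σ z = 0) : z = 0 := by
  rw [shear_apply] at h
  have h1 : z.im = 0 := by simpa [hσ] using congrArg Complex.im h
  have h2 : z.re = 0 := by simpa [h1] using congrArg Complex.re h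
  exact Complex.ext h2 h1

lemma exists_shear {ξ τ : ℂ} (hξ : 0 < ξ.im) (hτ : 0 < τ.im) :
    ∃ σ : ℂ, 0 < σ.im ∧ shear σ ξ = τ := by
  refine ⟨((1 / ξ.im : ℝ) : ℂ) * (τ - ξ.re), ?_, ?_⟩
  · rw [Complex.im_ofReal_mul]
    simp only [Complex.sub_im, Complex.ofReal_im, sub_zero]
    positivity
  · rw [shear_apply]
    have : (ξ.im : ℂ) ≠ 0 := by exact_mod_cast hξ.ne'
    push_cast
    field_simp
    ring

lemma Parallel.shear {u w : ℂ} (h : Parallel u w) (σ : ℂ) :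
    Parallel (UPolygons.shear σ u) (UPolygons.shear σ w) := by
  obtain ⟨r, hr, rfl⟩ := h
  exact ⟨r, hr, shear_mul _ _ _⟩

lemma Parallel.trans {u w z : ℂ} (h : Parallel u w) (h' : Parallel w z) : Parallel u z := by
  obtain ⟨r, hr, rfl⟩ := h
  obtain ⟨s, hs, rfl⟩ := h'
  exact ⟨s * r, mul_ne_zero hs hr, by push_cast; ring⟩

lemma Parallel.symm {u w : ℂ} (h : Parallel u w) : Parallel w u := by
  obtain ⟨r, hr, rfl⟩ := h
  refine ⟨r⁻¹, inv_ne_zero hr, ?_⟩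
  have : (r : ℂ) ≠ 0 := by exact_mod_cast hr
  push_cast
  field_simp

lemma exists_circle_parallel {z : ℂ} (hz : z ≠ 0) : ∃ u : Circle, Parallel (u : ℂ) z :=
  ⟨Circle.exp z.arg, ‖z‖, norm_ne_zero_iff.2 hz, by
    rw [Circle.coe_exp, Complex.norm_mul_exp_arg_mul_I]⟩

lemma isAffinelyRegularPolygon_shear {n : ℕ} {w : ZMod n → ℂ} (hw : IsRegularPolygon n w)
    {σ : ℂ} (hσ : σ.im ≠ 0) (s : ℂ) :
    IsAffinelyRegularPolygon n fun i ↦ shear σ (w i) + s := by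
  refine ⟨w, hw, ((LinearEquiv.ofInjectiveEndo (shear σ) ?_).toAffineEquiv).trans
    (AffineEquiv.constVAdd ℝ ℂ s), fun i ↦ ?_⟩
  · rw [injective_iff_map_eq_zero]
    exact fun z hz ↦ shear_eq_zero hσ hz
  · simp [add_comm]

lemma cross_zeta_pow_ne_zero {n k l : ℕ} (hkl : k < l) (hl : 2 * l < n) :
    cross (zeta n ^ k) (zeta n ^ l) ≠ 0 := by
  have h := zeta_pow_im_pos (n := n) (k := l - k) (by omega) (by omega)
  have e : zeta n ^ (l - k) = conj (zeta n ^ k) * zeta n ^ l := by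
    rw [map_pow, conj_zeta, inv_pow, ← Nat.sub_add_cancel hkl.le, pow_add]
    have := pow_ne_zero k (zeta_ne_zero n)
    simp
    field_simp
  rw [e] at h
  simp only [Complex.mul_im, Complex.conj_re, Complex.conj_im] at h
  simp only [cross]
  linarith

/-- The images of equiangular polygons with alternating edge lengths under `shear σ` are
`U`-polygons of class `4` for the directions of four consecutive edges. -/
lemma exists_directions {N : ℕ} [NeZero N] (hN : 4 ≤ N) {σ : ℂ} (hσ : 0 < σ.im) :
    ∃ U : Finset Circle, (∀ u ∈ U, ∃ k : ℕ, Parallel (u : ℂ) (shear σ (zeta (2 * N) ^ k))) ∧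
      ∀ ρ : ℝ, 0 < ρ → ∀ s : ℂ, IsUPolygon U (2 * N) (fun i ↦ shear σ (twoStep N ρ i) + s) ∧
        IsOfClass U (fun i ↦ shear σ (twoStep N ρ i) + s) 4 := by
  classical
  have h0 : ∀ k : ℕ, shear σ (zeta (2 * N) ^ k) ≠ 0 := fun k hk ↦
    pow_ne_zero k (zeta_ne_zero _) (shear_eq_zero hσ.ne' hk)
  choose u hu using fun k ↦ exists_circle_parallel (h0 k)
  have hlt : ∀ k l : ℕ, k < l → l < 4 → ¬ Parallel (u k : ℂ) (u l) := by
    intro k l hkl hl h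
    have h1 := (((hu k).symm.trans h).trans (hu l)).cross_eq_zero
    rw [cross_shear] at h1
    exact cross_zeta_pow_ne_zero hkl (by omega) ((mul_eq_zero.1 h1).resolve_left hσ.ne')
  have hpar : ∀ k l : ℕ, k < 4 → l < 4 → k ≠ l → ¬ Parallel (u k : ℂ) (u l) := by
    intro k l hk hl hkl h
    rcases hkl.lt_or_gt with h' | h'
    · exact hlt k l h' hl h
    · exact hlt l k h' hk h.symm
  have hcard : ((Finset.range 4).image u).card = 4 := by
    rw [Finset.card_image_of_injOn, Finset.card_range]
    intro k hk l hl h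
    by_contra hkl
    refine hpar k l (by simpa using hk) (by simpa using hl) hkl ?_
    rw [h]
    exact ⟨1, one_ne_zero, by simp⟩
  -- The class is exactly 4: edges 0 to 3 have directions in `U`, and runs longer than card U = 4
  -- are not counted. `U` does not depend on ρ.
  refine ⟨(Finset.range 4).image u, ?_, fun ρ hρ s ↦ ⟨⟨?_, ⟨by omega, ?_⟩, ?_⟩, by norm_num,
    ⟨hcard.ge, 0, ?_⟩, fun k hk ↦ hcard ▸ hk.1⟩⟩
  · intro x hx
    obtain ⟨k, -, rfl⟩ := Finset.mem_image.1 hx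
    exact ⟨k, hu k⟩
  · intro x hx y hy hxy
    obtain ⟨k, hk, rfl⟩ := Finset.mem_image.1 hx
    obtain ⟨l, hl, rfl⟩ := Finset.mem_image.1 hy
    exact hpar k l (by simpa using hk) (by simpa using hl) fun h ↦ hxy (by rw [h])
  · intro i j h1 h2
    rw [add_sub_add_right_eq_sub, add_sub_add_right_eq_sub, ← map_sub, ← map_sub, cross_shear]
    exact mul_pos hσ ((twoStep_isConvexPolygon (by omega) hρ).2 i j h1 h2)
  · intro i x hx
    obtain ⟨k, hk, rfl⟩ := Finset.mem_image.1 hx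
    obtain ⟨j, hj, h⟩ := twoStep_chord (by omega) hρ (k : ZMod (2 * N)) i
    refine ⟨j, hj, (hu k).trans ?_⟩
    rw [add_sub_add_right_eq_sub, ← map_sub, ← stdAddChar_natCast]
    exact h.shear σ
  · intro j hj
    refine ⟨u j, Finset.mem_image_of_mem _ (by simpa using hj), (hu j).trans ?_⟩
    dsimp only
    rw [add_sub_add_right_eq_sub, ← map_sub, twoStep_edge (by omega), zero_add,
      stdAddChar_natCast]
    exact ⟨_, (alternating_pos hρ _).ne', shear_mul _ _ _⟩

end Shear

end UPolygons
namespace UPolygons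

open scoped ComplexConjugate
open Real

/-! ### Arithmetic of L and ζ + ζ⁻¹. -/

section Arithmetic

variable {L : IntermediateField ℚ ℂ}

/-- The integral elements of `L`, as a subring of `ℂ`. -/
noncomputable def integralElements (L : IntermediateField ℚ ℂ) : Subring ℂ :=
  L.toSubring ⊓ (integralClosure ℤ ℂ).toSubring

lemma mem_integralElements {z : ℂ} : z ∈ integralElements L ↔ z ∈ L ∧ IsIntegral ℤ z := by
  rw [integralElements, Subring.mem_inf]
  rfl

lemma mem_integersOf {z : ℂ} : z ∈ integersOf L ↔ z ∈ integralElements L := by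
  rw [mem_integralElements]
  constructor
  · rintro ⟨x, rfl⟩
    exact ⟨(x : L).2, ((NumberField.RingOfIntegers.isIntegral_coe x).map
      (L.val.restrictScalars ℤ))⟩
  · rintro ⟨hz, hi⟩
    have : IsIntegral ℤ (⟨z, hz⟩ : L) :=
      (isIntegral_algHom_iff (L.val.restrictScalars ℤ) L.val.injective).1 hi
    exact ⟨⟨⟨z, hz⟩, this⟩, rfl⟩

lemma mem_realSubfield {z : ℂ} : z ∈ realSubfield ↔ z.im = 0 := by
  constructor
  · rintro ⟨x, rfl⟩
    exact Complex.ofReal_im x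
  · intro h
    exact ⟨z.re, Complex.ext (Complex.ofReal_re _) (by rw [h]; exact Complex.ofReal_im _)⟩

lemma realCyclotomic_le_iff {n : ℕ} :
    realCyclotomic n ≤ maxRealSubfield L ↔ zeta n + (zeta n)⁻¹ ∈ L := by
  rw [realCyclotomic, IntermediateField.adjoin_le_iff, Set.singleton_subset_iff, conj_zeta]
  refine ⟨fun h ↦ h.1, fun h ↦ ⟨h, mem_realSubfield.2 ?_⟩⟩
  rw [zeta_add_inv, Complex.ofReal_im]

lemma pow_add_inv_mem {S : Subring ℂ} {x : ℂ} (hx : x ≠ 0) (h : x + x⁻¹ ∈ S) (k : ℕ) :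
    x ^ k + (x ^ k)⁻¹ ∈ S := by
  induction k using Nat.twoStepInduction with
  | zero => simpa using S.add_mem S.one_mem S.one_mem
  | one => simpa using h
  | more k h0 h1 =>
    have := S.sub_mem (S.mul_mem h h1) h0
    convert this using 1
    field_simp
    ring

lemma isIntegral_zeta {n : ℕ} (hn : n ≠ 0) : IsIntegral ℤ (zeta n + (zeta n)⁻¹) :=
  ((isPrimitiveRoot_zeta hn).isIntegral (Nat.pos_of_ne_zero hn)).add
    ((isPrimitiveRoot_zeta hn).inv.isIntegral (Nat.pos_of_ne_zero hn))

lemma zeta_add_inv_mem_integralElements {n : ℕ} (hn : n ≠ 0) (h : zeta n + (zeta n)⁻¹ ∈ L) :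
    zeta n + (zeta n)⁻¹ ∈ integralElements L :=
  mem_integralElements.2 ⟨h, isIntegral_zeta hn⟩

lemma zeta_mul_pow (n : ℕ) {k : ℕ} (hk : k ≠ 0) : zeta (n * k) ^ k = zeta n := by
  rw [zeta_pow, zeta_eq]
  have : (k : ℝ) ≠ 0 := by exact_mod_cast hk
  congr 3
  push_cast
  field_simp

lemma zeta_two_mul_sq (N : ℕ) : zeta (2 * N) ^ 2 = zeta N := by
  rw [mul_comm]; exact zeta_mul_pow N two_ne_zero

lemma zeta_two_mul_of_odd {k : ℕ} :
    zeta (2 * (2 * k + 1)) = -zeta (2 * k + 1) ^ (k + 1) := by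
  rw [← zeta_two_mul_sq (2 * k + 1), ← pow_mul]
  have h : zeta (2 * (2 * k + 1)) ^ (2 * k + 1) = -1 := by
    have := zeta_pow (2 * (2 * k + 1)) (2 * k + 1)
    rw [this, ← Complex.exp_pi_mul_I]
    congr 2
    have : (2 * k + 1 : ℂ) ≠ 0 := by exact_mod_cast (2 * k).succ_ne_zero
    push_cast
    field_simp
  rw [show 2 * (k + 1) = 2 * k + 1 + 1 by ring, pow_succ, h]
  ring

lemma lcm_two (N : ℕ) : Nat.lcm N 2 = if Even N then N else 2 * N := by
  split_ifs with h
  · exact Nat.lcm_eq_left h.two_dvd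
  · rw [Nat.Coprime.lcm_eq_mul ((Nat.coprime_two_right).2 (Nat.not_even_iff_odd.1 h)), mul_comm]

/-- For odd N, ζ_{2N} is the negative of a power of ζ_N, and ζ_N is the square of ζ_{2N}. -/
lemma zeta_lcm_two_mem_iff {S : Subring ℂ} {N : ℕ} :
    zeta (Nat.lcm N 2) + (zeta (Nat.lcm N 2))⁻¹ ∈ S ↔ zeta N + (zeta N)⁻¹ ∈ S := by
  rw [lcm_two]
  split_ifs with h
  · rfl
  · constructor
    · intro h'
      rw [← zeta_two_mul_sq]
      exact pow_add_inv_mem (zeta_ne_zero _) h' 2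
    · intro h'
      obtain ⟨k, rfl⟩ := Nat.not_even_iff_odd.1 h
      have := S.neg_mem (pow_add_inv_mem (zeta_ne_zero _) h' (k + 1))
      rw [zeta_two_mul_of_odd, inv_neg]
      convert this using 1
      ring

lemma exists_nonreal_integral [NumberField L] (hcomplex : ¬ L ≤ realSubfield) :
    ∃ τ ∈ integralElements L, 0 < τ.im := by
  obtain ⟨z, hz, hr⟩ := SetLike.not_le_iff_exists.1 hcomplex
  rw [mem_realSubfield] at hr
  have halg : IsAlgebraic ℤ z := by
    have : IsAlgebraic ℚ (⟨z, hz⟩ : L) := Algebra.IsAlgebraic.isAlgebraic _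
    have h2 : IsAlgebraic ℚ z := (isAlgebraic_algHom_iff L.val L.val.injective).2 this
    exact (IsFractionRing.isAlgebraic_iff ℤ ℚ ℂ).2 h2
  obtain ⟨y, hy, hi⟩ := halg.exists_integral_multiple
  have hmem : y • z ∈ integralElements L := mem_integralElements.2 ⟨zsmul_mem hz y, hi⟩
  have him : (y • z).im ≠ 0 := by simp [hy, hr]
  rcases him.lt_or_gt with h | h
  · exact ⟨-(y • z), neg_mem hmem, by simpa using h⟩
  · exact ⟨y • z, hmem, h⟩

/-- A single cross product is an element of L divided by 2i and need not lie in L; the factor 2i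
cancels in quotients. -/
lemma cross_div_mem (hconj : ∀ z ∈ L, conj z ∈ L) {a b c d : ℂ} (ha : a ∈ L) (hb : b ∈ L)
    (hc : c ∈ L) (hd : d ∈ L) : ((cross a b / cross c d : ℝ) : ℂ) ∈ L := by
  have e : ∀ z w : ℂ, conj z * w - z * conj w = (cross z w : ℂ) * (2 * Complex.I) := by
    intro z w
    apply Complex.ext
    · simp [cross]
    · simp [cross]; ring
  have h : ((cross a b / cross c d : ℝ) : ℂ) =
      (conj a * b - a * conj b) / (conj c * d - c * conj d) := by
    rw [e, e, mul_div_mul_right _ _ (by simp), Complex.ofReal_div]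
  rw [h]
  exact div_mem (sub_mem (mul_mem (hconj a ha) hb) (mul_mem ha (hconj b hb)))
    (sub_mem (mul_mem (hconj c hc) hd) (mul_mem hc (hconj d hd)))

/-- The cross ratio is unchanged by rescaling the directions, so it can be computed from
representatives in L. Hypothesis `hd` serves both polygons in Λ and sets of Λ-directions. -/
lemma IsUPolygon.zeta_add_inv_mem (hconj : ∀ z ∈ L, conj z ∈ L) {N : ℕ} (hN : 4 ≤ N)
    {U : Finset Circle} {v : ZMod (2 * N) → ℂ} {c : ℕ} (hc : 4 ≤ c)
    (hU : IsUPolygon U (2 * N) v) (hcl : IsOfClass U v c)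
    (hd : ∀ i, ∀ u ∈ U, Parallel (u : ℂ) (v (i + 1) - v i) → ∃ d ∈ L, Parallel (u : ℂ) d) :
    zeta N + (zeta N)⁻¹ ∈ L := by
  obtain ⟨-, ⟨-, e, he⟩, -⟩ := hcl
  have hedge : ∀ k : ℕ, k < 4 → ∃ u ∈ U, Parallel (u : ℂ) (v (e + k + 1) - v (e + k)) :=
    fun k hk ↦ he k (by omega)
  choose! u hu hue using hedge
  have hdir : ∀ k : ℕ, k < 4 → ∃ d ∈ L, Parallel (u k : ℂ) d :=
    fun k hk ↦ hd (e + k) (u k) (hu k hk) (hue k hk)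
  choose! d hdL hdp using hdir
  obtain ⟨-, -, η, hη, hs⟩ := hU.exists_isPrimitiveRoot hN e u hu hue d hdp
  have hmem : η + η⁻¹ ∈ L := by
    rw [hs, Complex.ofReal_mul]
    exact sub_mem (mul_mem
      (cross_div_mem hconj (hdL 1 (by norm_num)) (hdL 2 (by norm_num)) (hdL 0 (by norm_num))
        (hdL 1 (by norm_num)))
      (cross_div_mem hconj (hdL 0 (by norm_num)) (hdL 3 (by norm_num)) (hdL 2 (by norm_num))
        (hdL 3 (by norm_num)))) (one_mem L)
  have : NeZero N := ⟨by omega⟩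
  obtain ⟨k, -, hk⟩ := hη.eq_pow_of_pow_eq_one
    (isPrimitiveRoot_zeta (show N ≠ 0 by omega)).pow_eq_one
  rw [← hk]
  exact pow_add_inv_mem (S := L.toSubring) (hη.ne_zero (by omega)) hmem k

/-- In a regular polygon the chord from 0 to 3 is 1 + 2 Re ζ times the edge from 1 to 2, and affine
maps preserve this ratio. -/
lemma IsAffinelyRegularPolygon.zeta_add_inv_mem {n : ℕ} (hn : 4 ≤ n) {v : ZMod n → ℂ}
    (hv : IsAffinelyRegularPolygon n v) (hL : ∀ i j, v i - v j ∈ L) :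
    zeta n + (zeta n)⁻¹ ∈ L := by
  obtain ⟨w, ⟨-, a, r, hr, hw⟩, Ψ, hΨ⟩ := hv
  have hval : ∀ k : ℕ, k < 4 → w k = a + r * zeta n ^ k := by
    intro k hk
    rw [hw, ZMod.val_natCast_of_lt (by omega)]
  have hsub : ∀ i j, v i - v j = Ψ.linear (w i - w j) := by
    intro i j
    rw [hΨ, hΨ]
    exact (Ψ.toAffineMap.linearMap_vsub (w i) (w j)).symm
  have hz := zeta_ne_zero n
  have hz1 : zeta n ≠ 1 := (isPrimitiveRoot_zeta (by omega)).ne_one (by omega)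
  have hne : v (2 : ℕ) - v (1 : ℕ) ≠ 0 := by
    rw [hsub, LinearEquiv.map_ne_zero_iff, hval 2 (by norm_num), hval 1 (by norm_num)]
    have : a + r * zeta n ^ 2 - (a + r * zeta n ^ 1) = r * (zeta n * (zeta n - 1)) := by ring
    rw [this]
    exact mul_ne_zero hr (mul_ne_zero hz (sub_ne_zero.2 hz1))
  have key : v (3 : ℕ) - v (0 : ℕ) =
      ((1 + 2 * (zeta n).re : ℝ) : ℂ) * (v (2 : ℕ) - v (1 : ℕ)) := by
    rw [hsub, hsub, ← Complex.real_smul, ← LinearEquiv.map_smul, Complex.real_smul,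
      hval 3 (by norm_num), hval 0 (by norm_num), hval 2 (by norm_num), hval 1 (by norm_num),
      Complex.ofReal_add, ← zeta_add_inv]
    congr 1
    push_cast
    field_simp
    ring
  have h1 : zeta n + (zeta n)⁻¹ = (v (3 : ℕ) - v (0 : ℕ)) / (v (2 : ℕ) - v (1 : ℕ)) - 1 := by
    rw [key, zeta_add_inv, mul_div_assoc, div_self hne]
    push_cast
    ring
  rw [h1]
  exact sub_mem (div_mem (hL _ _) (hL _ _)) (one_mem L)

lemma shear_pow_mem {S : Subring ℂ} {n : ℕ} (h : zeta n + (zeta n)⁻¹ ∈ S) {σ : ℂ}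
    (hσ : shear σ (zeta n) ∈ S) (k : ℕ) : shear σ (zeta n ^ k) ∈ S := by
  induction k using Nat.twoStepInduction with
  | zero => simp [shear_apply, S.one_mem]
  | one => simpa using hσ
  | more k h0 h1 =>
    have e : zeta n ^ (k + 2) =
        ((2 * (zeta n).re : ℝ) : ℂ) * zeta n ^ (k + 1) - zeta n ^ k := by
      have := zeta_ne_zero n
      rw [← zeta_add_inv]
      field_simp
      ring
    rw [e, map_sub, shear_mul]
    rw [zeta_add_inv] at h
    exact S.sub_mem (S.mul_mem h h1) h0

/-- The factor 2 Re ζ_{2N} = ζ_{2N} + ζ_{2N}⁻¹ turns an odd power of ζ_{2N} into a sum of two powers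
of ζ_N. -/
lemma shear_alternating_mem {S : Subring ℂ} {N : ℕ} (h : zeta N + (zeta N)⁻¹ ∈ S) {σ : ℂ}
    (hσ : shear σ (zeta N) ∈ S) (k : ℕ) :
    shear σ (((if Even k then 1 else 2 * (zeta (2 * N)).re : ℝ) : ℂ) * zeta (2 * N) ^ k) ∈ S := by
  split_ifs with hk
  · obtain ⟨j, rfl⟩ := hk.two_dvd
    rw [pow_mul, zeta_two_mul_sq, Complex.ofReal_one, one_mul]
    exact shear_pow_mem h hσ j
  · obtain ⟨j, rfl⟩ := Nat.not_even_iff_odd.1 hk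
    have e : ((2 * (zeta (2 * N)).re : ℝ) : ℂ) * zeta (2 * N) ^ (2 * j + 1) =
        zeta N ^ (j + 1) + zeta N ^ j := by
      have := zeta_ne_zero (2 * N)
      rw [← zeta_add_inv, ← zeta_two_mul_sq N]
      field_simp
      ring
    rw [e, map_add]
    exact S.add_mem (shear_pow_mem h hσ _) (shear_pow_mem h hσ _)

/-- ζ_N is a root of X² - (ζ_N + ζ_N⁻¹)X + 1, so it has degree at most 2 over L, while its degree
over ℚ is φ(N). -/
lemma totient_le_of_zeta_add_inv_mem [NumberField L] {N : ℕ} (hN : N ≠ 0)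
    (h : zeta N + (zeta N)⁻¹ ∈ L) : N.totient ≤ Module.finrank ℚ L * 2 := by
  have hprim := isPrimitiveRoot_zeta hN
  let p : Polynomial L := .X ^ 2 - .C ⟨_, h⟩ * .X + 1
  have hpd : p.natDegree = 2 := by
    simp only [p]; compute_degree!
  have hp0 : p ≠ 0 := by
    intro h0
    rw [h0] at hpd
    simp at hpd
  have hroot : Polynomial.aeval (zeta N) p = 0 := by
    have e : algebraMap L ℂ ⟨_, h⟩ = zeta N + (zeta N)⁻¹ := rfl
    have := zeta_ne_zero N
    simp only [p, map_add, map_sub, map_mul, map_pow, Polynomial.aeval_X, Polynomial.aeval_C,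
      map_one, e]
    field_simp
    ring
  have hint : IsIntegral L (zeta N) := isAlgebraic_iff_isIntegral.1 ⟨p, hp0, hroot⟩
  let K : IntermediateField L ℂ := IntermediateField.adjoin L {zeta N}
  have : FiniteDimensional L K := IntermediateField.adjoin.finiteDimensional hint
  have hK : Module.finrank L K ≤ 2 := by
    rw [IntermediateField.adjoin.finrank hint, ← hpd]
    exact Polynomial.natDegree_le_of_dvd (minpoly.dvd _ _ hroot) hp0
  have : FiniteDimensional ℚ K := FiniteDimensional.trans ℚ L K
  let z : K := ⟨zeta N, IntermediateField.mem_adjoin_simple_self L _⟩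
  have hz : minpoly ℚ (zeta N) = minpoly ℚ z :=
    minpoly.algebraMap_eq (B := K) (B' := ℂ) (algebraMap K ℂ).injective z
  calc N.totient = (minpoly ℚ (zeta N)).natDegree := by
        rw [← Polynomial.cyclotomic_eq_minpoly_rat hprim (Nat.pos_of_ne_zero hN),
          Polynomial.natDegree_cyclotomic]
    _ ≤ Module.finrank ℚ K := by rw [hz]; exact minpoly.natDegree_le z
    _ = Module.finrank ℚ L * Module.finrank L K := (Module.finrank_mul_finrank ℚ L K).symm
    _ ≤ _ := Nat.mul_le_mul_left _ hK

/-- A prime power q dividing N satisfies q ≤ 2φ(q) ≤ 2φ(N) ≤ 2B. -/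
lemma dvd_factorial_of_totient_le {N B : ℕ} (hN : N ≠ 0) (h : N.totient ≤ B) :
    N ∣ (2 * B).factorial := by
  rw [Nat.dvd_iff_prime_pow_dvd_dvd]
  intro p k hp hk
  rcases Nat.eq_zero_or_pos k with rfl | hk0
  · simp
  refine Nat.dvd_factorial (pow_pos hp.pos k) ?_
  have h1 : (p ^ k).totient ≤ N.totient :=
    Nat.le_of_dvd (Nat.totient_pos.2 (Nat.pos_of_ne_zero hN)) (Nat.totient_dvd_of_dvd hk)
  rw [Nat.totient_prime_pow hp hk0] at h1
  have h2 : p ≤ 2 * (p - 1) := by have := hp.two_le; omega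
  calc p ^ k = p ^ (k - 1) * p := by rw [← pow_succ, Nat.sub_add_cancel hk0]
    _ ≤ p ^ (k - 1) * (2 * (p - 1)) := Nat.mul_le_mul_left _ h2
    _ = 2 * (p ^ (k - 1) * (p - 1)) := by ring
    _ ≤ 2 * B := Nat.mul_le_mul_left _ (h1.trans h)

end Arithmetic

/-! ### The implications between the four conditions. -/

section Main

variable {L : IntermediateField ℚ ℂ} {Λ : Set ℂ} {t : ℂ}

/-- Both kinds of Λ lie between a translate of the ring of integers and the same translate of L;
nothing else about Λ is needed. -/
lemma exists_translation
    (hΛ : IsTranslateOf Λ (L : Set ℂ) ∨ IsTranslateOf Λ (integersOf L)) :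
    ∃ t : ℂ, (∀ z ∈ integralElements L, z + t ∈ Λ) ∧ ∀ x ∈ Λ, x - t ∈ L := by
  rcases hΛ with ⟨t, rfl⟩ | ⟨t, rfl⟩
  · refine ⟨t, fun z hz ↦ ⟨z, (mem_integralElements.1 hz).1, rfl⟩, ?_⟩
    rintro _ ⟨z, hz, rfl⟩
    simpa using hz
  · refine ⟨t, fun z hz ↦ ⟨z, mem_integersOf.2 hz, rfl⟩, ?_⟩
    rintro _ ⟨z, hz, rfl⟩
    simpa using (mem_integralElements.1 (mem_integersOf.1 hz)).1

lemma sub_mem_of_translation (ht : ∀ x ∈ Λ, x - t ∈ L) {x y : ℂ} (hx : x ∈ Λ) (hy : y ∈ Λ) :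
    x - y ∈ L := by
  have := sub_mem (ht x hx) (ht y hy)
  rwa [sub_sub_sub_cancel_right] at this

lemma HasUPolygon.zeta_add_inv_mem (hconj : ∀ z ∈ L, conj z ∈ L) (ht : ∀ x ∈ Λ, x - t ∈ L)
    {N : ℕ} (hN : 4 ≤ N) (h : HasUPolygon Λ (2 * N)) : zeta N + (zeta N)⁻¹ ∈ L := by
  obtain ⟨U, v, c, hc, hU, hcl, hv⟩ := h
  exact hU.zeta_add_inv_mem hconj hN hc hcl
    fun i u _ hp ↦ ⟨_, sub_mem_of_translation ht (hv _) (hv _), hp⟩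

lemma HasAffinelyRegularUPolygon.zeta_add_inv_mem (hconj : ∀ z ∈ L, conj z ∈ L)
    (ht : ∀ x ∈ Λ, x - t ∈ L) {N : ℕ} (hN : 4 ≤ N)
    (h : HasAffinelyRegularUPolygon Λ (2 * N)) : zeta N + (zeta N)⁻¹ ∈ L := by
  obtain ⟨U, v, c, hc, hd, hU, hcl, -⟩ := h
  refine hU.zeta_add_inv_mem hconj hN hc hcl fun i u hu _ ↦ ?_
  obtain ⟨x, hx, y, hy, -, hp⟩ := hd u hu
  exact ⟨_, sub_mem_of_translation ht hx hy, hp⟩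

lemma four_le_lcm_two {N : ℕ} (hN : 4 ≤ N) : 4 ≤ Nat.lcm N 2 := by
  rw [lcm_two]; split_ifs <;> omega

lemma HasAffinelyRegularPolygon.zeta_add_inv_mem (ht : ∀ x ∈ Λ, x - t ∈ L) {N : ℕ}
    (hN : 4 ≤ N) (h : HasAffinelyRegularPolygon Λ (Nat.lcm N 2)) :
    zeta N + (zeta N)⁻¹ ∈ L := by
  obtain ⟨v, hv, hvΛ⟩ := h
  exact (zeta_lcm_two_mem_iff (S := L.toSubring)).1 <|
    hv.zeta_add_inv_mem (four_le_lcm_two hN) fun i j ↦ sub_mem_of_translation ht (hvΛ i) (hvΛ j)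

lemma hasAffinelyRegularPolygon_of_mem [NumberField L] (hcomplex : ¬ L ≤ realSubfield)
    (ht : ∀ z ∈ integralElements L, z + t ∈ Λ) {N : ℕ} (hN : 4 ≤ N)
    (h : zeta N + (zeta N)⁻¹ ∈ L) : HasAffinelyRegularPolygon Λ (Nat.lcm N 2) := by
  have hn := four_le_lcm_two hN
  have hmem := zeta_lcm_two_mem_iff.2 (zeta_add_inv_mem_integralElements (by omega) h)
  obtain ⟨τ, hτ, hτ0⟩ := exists_nonreal_integral hcomplex
  obtain ⟨σ, hσ, hσz⟩ := exists_shear (zeta_im_pos (n := Nat.lcm N 2) (by omega)) hτ0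
  refine ⟨_, isAffinelyRegularPolygon_shear
    (w := fun i ↦ zeta (Nat.lcm N 2) ^ i.val) ⟨by omega, 0, 1, one_ne_zero, by simp⟩
    hσ.ne' t, fun i ↦ ht _ (shear_pow_mem hmem (by rwa [hσz]) _)⟩

lemma hasAffinelyRegularUPolygon_of_mem [NumberField L] (hcomplex : ¬ L ≤ realSubfield)
    (ht : ∀ z ∈ integralElements L, z + t ∈ Λ) {N : ℕ} (hN : 4 ≤ N)
    (h : zeta N + (zeta N)⁻¹ ∈ L) : HasAffinelyRegularUPolygon Λ (2 * N) := by
  have : NeZero N := ⟨by omega⟩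
  have hmem := zeta_add_inv_mem_integralElements (by omega) h
  obtain ⟨τ, hτ, hτ0⟩ := exists_nonreal_integral hcomplex
  obtain ⟨σ, hσ, hσz⟩ := exists_shear (zeta_im_pos (n := N) (by omega)) hτ0
  obtain ⟨U, hU, hpoly⟩ := exists_directions hN hσ
  obtain ⟨h1, h2⟩ := hpoly 1 one_pos 0
  refine ⟨U, _, 4, le_rfl, fun u hu ↦ ?_, h1, h2,
    isAffinelyRegularPolygon_shear (twoStep_one_isRegularPolygon (by omega)) hσ.ne' 0⟩
  obtain ⟨k, hk⟩ := hU u hu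
  have hr : (if Even k then 1 else 2 * (zeta (2 * N)).re : ℝ) ≠ 0 := by
    have := zeta_re_pos (n := 2 * N) (by omega)
    split_ifs <;> positivity
  refine ⟨_, ht _ (shear_alternating_mem hmem (by rwa [hσz]) k), _, ht 0 (zero_mem _), ?_, ?_⟩
  · rw [add_sub_add_right_eq_sub, sub_zero]
    intro h0
    refine mul_ne_zero (Complex.ofReal_ne_zero.2 hr) (pow_ne_zero k (zeta_ne_zero _))
      (shear_eq_zero hσ.ne' h0)
  · rw [add_sub_add_right_eq_sub, sub_zero]
    exact hk.trans ⟨_, hr, shear_mul _ _ _⟩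

lemma hasUPolygon_of_mem [NumberField L] (hcomplex : ¬ L ≤ realSubfield)
    (ht : ∀ z ∈ integralElements L, z + t ∈ Λ) {N : ℕ} (hN : 4 ≤ N)
    (h : zeta N + (zeta N)⁻¹ ∈ L) : HasUPolygon Λ (2 * N) := by
  have : NeZero N := ⟨by omega⟩
  have hmem := zeta_add_inv_mem_integralElements (by omega) h
  obtain ⟨τ, hτ, hτ0⟩ := exists_nonreal_integral hcomplex
  obtain ⟨σ, hσ, hσz⟩ := exists_shear (zeta_im_pos (n := N) (by omega)) hτ0
  obtain ⟨U, -, hpoly⟩ := exists_directions hN hσ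
  set ρ := 2 * (zeta (2 * N)).re with hρ
  have hρ0 : 0 < ρ := by
    have := zeta_re_pos (n := 2 * N) (by omega)
    positivity
  -- This translation puts vertex 0 at `t`; the other vertices follow by adding edges, which are
  -- integral for this ρ.
  obtain ⟨h1, h2⟩ := hpoly ρ hρ0 (t - shear σ (twoStep N ρ 0))
  refine ⟨U, _, 4, le_rfl, h1, h2, fun i ↦ ?_⟩
  have key : ∀ k : ℕ, shear σ (twoStep N ρ k) - shear σ (twoStep N ρ 0) ∈
      integralElements L := by
    intro k
    induction k with
    | zero => simp
    | succ k ih =>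
      have := add_mem ih (shear_alternating_mem hmem (by rwa [hσz]) k)
      rw [← alternating_natCast (N := N), ← stdAddChar_natCast, ← twoStep_edge (by omega),
        map_sub] at this
      rw [Nat.cast_succ]
      convert this using 1
      ring
  have := ht _ (key i.val)
  rw [ZMod.natCast_zmod_val] at this
  convert this using 1
  ring

end Main

end UPolygons
theorem corollary3p2 (L : IntermediateField ℚ ℂ) [NumberField L]
    (hcomplex : ¬ L ≤ UPolygons.realSubfield)
    (hconj : ∀ z ∈ L, (starRingEnd ℂ) z ∈ L)
    (Λ : Set ℂ)
    (hΛ : UPolygons.IsTranslateOf Λ (L : Set ℂ) ∨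
      UPolygons.IsTranslateOf Λ (UPolygons.integersOf L)) :
    (∀ m : ℕ, 8 ≤ m → Even m →
      List.TFAE [
        UPolygons.HasUPolygon Λ m,
        UPolygons.HasAffinelyRegularUPolygon Λ m,
        UPolygons.realCyclotomic (m / 2) ≤ UPolygons.maxRealSubfield L,
        UPolygons.HasAffinelyRegularPolygon Λ (Nat.lcm (m / 2) 2)]) ∧
    {m : ℕ | 8 ≤ m ∧ Even m ∧
      (UPolygons.HasUPolygon Λ m ∨
        UPolygons.HasAffinelyRegularUPolygon Λ m ∨
        UPolygons.realCyclotomic (m / 2) ≤ UPolygons.maxRealSubfield L ∨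
        UPolygons.HasAffinelyRegularPolygon Λ (Nat.lcm (m / 2) 2))}.Finite := by
  obtain ⟨t, ht, htL⟩ := UPolygons.exists_translation hΛ
  have main : ∀ m : ℕ, 8 ≤ m → Even m →
      List.TFAE [
        UPolygons.HasUPolygon Λ m,
        UPolygons.HasAffinelyRegularUPolygon Λ m,
        UPolygons.realCyclotomic (m / 2) ≤ UPolygons.maxRealSubfield L,
        UPolygons.HasAffinelyRegularPolygon Λ (Nat.lcm (m / 2) 2)] := by
    intro m hm hev
    obtain ⟨N, rfl⟩ := hev.two_dvd
    have hN : 4 ≤ N := by omega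
    rw [Nat.mul_div_cancel_left N two_pos, UPolygons.realCyclotomic_le_iff]
    tfae_have 1 → 3 := fun h ↦ h.zeta_add_inv_mem hconj htL hN
    tfae_have 2 → 3 := fun h ↦ h.zeta_add_inv_mem hconj htL hN
    tfae_have 4 → 3 := fun h ↦ h.zeta_add_inv_mem htL hN
    tfae_have 3 → 1 := UPolygons.hasUPolygon_of_mem hcomplex ht hN
    tfae_have 3 → 2 := UPolygons.hasAffinelyRegularUPolygon_of_mem hcomplex ht hN
    tfae_have 3 → 4 := UPolygons.hasAffinelyRegularPolygon_of_mem hcomplex ht hN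
    tfae_finish
  -- Here m = 2N, and N divides (2B)! with B = 2[L : ℚ].
  refine ⟨main, (Set.finite_le_nat
    (2 * (2 * (Module.finrank ℚ L * 2)).factorial)).subset ?_⟩
  rintro m ⟨hm, hev, h⟩
  have hmem : UPolygons.realCyclotomic (m / 2) ≤ UPolygons.maxRealSubfield L := by
    rcases h with h | h | h | h
    · exact ((main m hm hev).out 0 2).1 h
    · exact ((main m hm hev).out 1 2).1 h
    · exact h
    · exact ((main m hm hev).out 3 2).1 h
  obtain ⟨N, rfl⟩ := hev.two_dvd
  rw [Nat.mul_div_cancel_left N two_pos, UPolygons.realCyclotomic_le_iff] at hmem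
  have hN : N ≠ 0 := by omega
  exact Nat.mul_le_mul_left 2 <| Nat.le_of_dvd (Nat.factorial_pos _) <|
    UPolygons.dvd_factorial_of_totient_le hN
      (UPolygons.totient_le_of_zeta_add_inv_mem hN hmem)
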